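/- **Setting.** Let $X$ be a complete separable metric space with Borel $\sigma$-algebra $\mathcal A$, let $\mu$ be a boundedly finite measure on $X$ (bounded sets have finite measure) with $\mu(X)=\infty$, and let $T$ be an invertible bimeasurable transformation of $X$ preserving $\mu$ such that $(X,\mathcal A,\mu,T)$ is conservative and ergodic. For $n\ge 1$ write $T^{\times n}$ for the diagonal action $T\times\cdots\times T$ on $X^n$. For a partition $\pi$ of $\{1,\dots,n\}$ and $\kappa=(k_1,\dots,k_n)\in\mathbb Z^n$, let $m_\pi^\kappa$ be the measure on $X^n$ defined by $$m_\pi^\kappa(A_1\times\cdots\times A_n)=\prod_{P\in\pi}\mu\Bigl(\bigcap_{i\in P}T^{-k_i}A_i\Bigr);$$ $\kappa$ is called $\pi$-compatible if $k_i=0$ whenever $i$ is the smallest element of its atom in $\pi$. Assume that * (P1) for each $n\ge 1$, the system $(X^n,\mathcal A^{\otimes n},\mu^{\otimes n},T^{\times n})$ is ergodic; * (P2) for each $n\ge 1$, every boundedly finite $T^{\times n}$-invariant measure on $X^n$ whose marginals are absolutely continuous with respect to $\mu$ is conservative, and its ergodic components are all, up to positive multiplicative constants, of the form $m_\pi^\kappa$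 for some partition $\pi$ of $\{1,\dots,n\}$ and some $\pi$-compatible $\kappa$. Let $X^*$ be the set of boundedly finite measures on $X$ of the form $\sum_{i\in I}\delta_{x_i}$ with $I$ countable and the $x_i$ pairwise distinct, equipped with the $\sigma$-algebra $\mathcal A^*$ generated by the maps $\xi\mapsto\xi(A)$, $A\in\mathcal A$. Let $S$ be an invertible transformation of a probability space $(\Omega,\mathscr F,\mathbb P)$ which preserves $\mathbb P$. A $T$-point process on $(\Omega,\mathscr F,\mathbb P,S)$ is a random variable $N:\Omega\to X^*$ such that, for every $A\in\mathcal A$, $N(A)\circ S=N(T^{-1}A)$ almost surely, and $N(A)=0$ almost surely if $\mu(A)=0$. It is Poisson of intensity $\nu$ if, for all $r\ge 1$ and all pairwise disjoint $A_1,\dots,A_r\in\mathcal A$ with $0<\nu(A_i)<\infty$, the variables $N(A_1),\dots,N(A_r)$ are independent and Poisson distributed with parameters $\nu(A_1),\dots,\nu(A_r)$. Two $T$-point processes $N,N'$ on $(\Omega,\mathscr F,\mathbb P,S)$ are dissociated if, for every $\ell\in\mathbb Z$, almost surely $N$ and $N'\circ S^\ell$ have no common point. **Proposition.** Let $(\Omega,\mathscr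 F,\mathbb P,S)$ be ergodic, let $\alpha_1,\dots,\alpha_k\in(0,\infty)$, and let $N_1,\dots,N_k$ be Poisson $T$-point processes on $(\Omega,\mathscr F,\mathbb P,S)$, of respective intensities $\alpha_1\mu,\dots,\alpha_k\mu$. If $N_i$ and $N_j$ are dissociated for all $i\ne j$, then $N_1,\dots,N_k$ are independent. -/

import Mathlib

open MeasureTheory ProbabilityTheory Set
open scoped NNReal ENNReal

noncomputable section

namespace TPoint

/-- A measure on a metric space is boundedly finite if bounded sets have finite mass. (Requiring this
of bounded Borel sets only is the same, since the closure of a bounded set is bounded.) -/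
def BoundedlyFinite {Z : Type*} [Bornology Z] [MeasurableSpace Z] (m : Measure Z) : Prop :=
  ∀ B : Set Z, Bornology.IsBounded B → m B < ∞

/-- A simple counting measure: boundedly finite, and a sum of Dirac masses at the points of a
countable set (so at pairwise distinct points). -/
def IsSimpleCounting {X : Type*} [Bornology X] [MeasurableSpace X] (ξ : Measure X) : Prop :=
  BoundedlyFinite ξ ∧
    ∃ s : Set X, s.Countable ∧ ξ = Measure.sum fun x : s => Measure.dirac (x : X)

/-- The space `X^*` of simple counting measures on `X`. Its sigma-algebra is the restriction of
the one on `Measure X`, generated by the maps `ξ ↦ ξ A`, `A` measurable; on boundedly finite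
measures the bounded `A` generate the same one, because `X` is a countable increasing union of
bounded measurable sets. -/
abbrev Config (X : Type*) [Bornology X] [MeasurableSpace X] : Type _ :=
  {ξ : Measure X // IsSimpleCounting ξ}

section Dynamics

variable {X : Type*} [MeasurableSpace X]

/-- The power `T ^ k`, `k ∈ ℤ`, of an invertible bimeasurable transformation. -/
def zpowMap (T : X ≃ᵐ X) (k : ℤ) : X → X :=
  ⇑((show Equiv.Perm X from T.toEquiv) ^ k)

theorem measurable_zpowMap (T : X ≃ᵐ X) (k : ℤ) : Measurable (zpowMap T k) := by
  have key : ∀ (R : X ≃ᵐ X) (m : ℕ),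
      Measurable ⇑((show Equiv.Perm X from R.toEquiv) ^ m) := by
    intro R m
    rw [Equiv.Perm.coe_pow]
    exact R.measurable.iterate m
  cases k with
  | ofNat m => simpa [zpowMap] using key T m
  | negSucc m =>
    have h := key T.symm (m + 1)
    have e : (show Equiv.Perm X from T.symm.toEquiv) =
        (show Equiv.Perm X from T.toEquiv)⁻¹ := rfl
    rw [e, inv_pow] at h
    rw [zpowMap, zpow_negSucc]
    exact h

/-- The diagonal action `T × ⋯ × T` on `X ^ n`. -/
def prodMap (T : X ≃ᵐ X) (n : ℕ) : (Fin n → X) → (Fin n → X) := fun x i => T (x i)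

/-- The atom of the partition `π` of `{1, …, n}` that contains `i`. -/
def atom {n : ℕ} (π : Finpartition (Finset.univ : Finset (Fin n))) (i : Fin n) :
    {P : Finset (Fin n) // P ∈ π.parts} :=
  ⟨π.part i, π.part_mem.2 (Finset.mem_univ i)⟩

/-- The measure `m_π^κ` on `X ^ n`: the image of `μ^{⊗ π}` (one factor for each atom of `π`) under
`(x_P)_P ↦ (T ^ {k_i} x_{P(i)})_i`, where `P(i)` is the atom containing `i`. Its value on boxes
is computed in `partMeasure_box`. -/
def partMeasure (T : X ≃ᵐ X) (μ : Measure X) {n : ℕ}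
    (π : Finpartition (Finset.univ : Finset (Fin n))) (κ : Fin n → ℤ) : Measure (Fin n → X) :=
  (Measure.pi fun _ : {P : Finset (Fin n) // P ∈ π.parts} => μ).map
    fun x i => zpowMap T (κ i) (x (atom π i))

theorem partMeasure_box (T : X ≃ᵐ X) (μ : Measure X) [SigmaFinite μ] {n : ℕ}
    (π : Finpartition (Finset.univ : Finset (Fin n))) (κ : Fin n → ℤ)
    (A : Fin n → Set X) (hA : ∀ i, MeasurableSet (A i)) :
    partMeasure T μ π κ (Set.pi Set.univ A) =
      ∏ P ∈ π.parts, μ (⋂ i ∈ P, zpowMap T (κ i) ⁻¹' A i) := by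
  have hm : Measurable fun (x : {P : Finset (Fin n) // P ∈ π.parts} → X) (i : Fin n) =>
      zpowMap T (κ i) (x (atom π i)) :=
    measurable_pi_lambda _ fun i => (measurable_zpowMap T (κ i)).comp (measurable_pi_apply _)
  have hpre : (fun (x : {P : Finset (Fin n) // P ∈ π.parts} → X) (i : Fin n) =>
      zpowMap T (κ i) (x (atom π i))) ⁻¹' (Set.pi Set.univ A) =
      Set.pi Set.univ fun P : {P : Finset (Fin n) // P ∈ π.parts} =>
        ⋂ i ∈ P.1, zpowMap T (κ i) ⁻¹' A i := by
    ext x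
    simp only [Set.mem_preimage, Set.mem_pi, Set.mem_univ, true_imp_iff, Set.mem_iInter]
    constructor
    · intro h P i hi
      have : atom π i = P := Subtype.ext (π.part_eq_of_mem P.2 hi)
      rw [← this]
      exact h i
    · intro h i
      exact h (atom π i) i (π.mem_part (Finset.mem_univ i))
  rw [partMeasure, Measure.map_apply hm (MeasurableSet.univ_pi hA), hpre, Measure.pi_pi]
  exact Finset.prod_coe_sort π.parts fun P => μ (⋂ i ∈ P, zpowMap T (κ i) ⁻¹' A i)

/-- `κ` is `π`-compatible: `k_i = 0` whenever `i` is the smallest element of its atom. -/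
def IsCompatible {n : ℕ} (π : Finpartition (Finset.univ : Finset (Fin n))) (κ : Fin n → ℤ) :
    Prop :=
  ∀ P ∈ π.parts, ∀ i ∈ P, (∀ j ∈ P, i ≤ j) → κ i = 0

/-- `(η_y)_{y ∈ Y}`, integrated against `ρ`, is an ergodic decomposition of the `R`-invariant
measure `σ`: `σ = ∫ η_y dρ(y)`, where almost all the components `η_y` are nonzero, σ-finite,
`R`-invariant and ergodic. -/
structure IsErgodicDecomposition {Z Y : Type*} [MeasurableSpace Z] [MeasurableSpace Y]
    (R : Z → Z) (σ : Measure Z) (ρ : Measure Y) (η : Y → Measure Z) : Prop where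
  sigmaFinite_base : SigmaFinite ρ
  measurable : Measurable η
  eq_bind : σ = ρ.bind η
  ergodic : ∀ᵐ y ∂ρ, η y ≠ 0 ∧ SigmaFinite (η y) ∧ Ergodic R (η y)

/-- Property (P1): all the finite direct products of the system with itself are ergodic. -/
def PropertyP1 (T : X ≃ᵐ X) (μ : Measure X) : Prop :=
  ∀ n : ℕ, 1 ≤ n → Ergodic (prodMap T n) (Measure.pi fun _ : Fin n => μ)

end Dynamics

/-- Property (P2): every boundedly finite, `T × ⋯ × T`-invariant measure on `X ^ n` whose marginals
are absolutely continuous with respect to `μ` is conservative, and its ergodic components are all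
of the form `m_π^κ` with `κ` a `π`-compatible family. (Components of an infinite measure are only
defined up to a positive multiplicative constant.) -/
def PropertyP2 {X : Type*} [MetricSpace X] [MeasurableSpace X] (T : X ≃ᵐ X) (μ : Measure X) :
    Prop :=
  ∀ n : ℕ, 1 ≤ n → ∀ σ : Measure (Fin n → X), BoundedlyFinite σ →
    MeasurePreserving (prodMap T n) σ σ →
    (∀ i : Fin n, σ.map (fun x => x i) ≪ μ) →
    Conservative (prodMap T n) σ ∧
      ∃ (Y : Type) (_ : MeasurableSpace Y) (ρ : Measure Y) (η : Y → Measure (Fin n → X)),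
        IsErgodicDecomposition (prodMap T n) σ ρ η ∧
        ∀ᵐ y ∂ρ, ∃ (π : Finpartition (Finset.univ : Finset (Fin n))) (κ : Fin n → ℤ) (c : ℝ≥0),
          IsCompatible π κ ∧ c ≠ 0 ∧ η y = c • partMeasure T μ π κ

section Processes

variable {X Ω : Type*} [MetricSpace X] [MeasurableSpace X] [MeasurableSpace Ω]

/-- `N` is a `T`-point process on the system `(Ω, P, S)`. -/
structure IsTPointProcess (T : X ≃ᵐ X) (μ : Measure X) (P : Measure Ω) (S : Ω ≃ᵐ Ω)
    (N : Ω → Config X) : Prop where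
  measurable : Measurable N
  null : ∀ A : Set X, MeasurableSet A → μ A = 0 → ∀ᵐ ω ∂P, (N ω).1 A = 0
  measurePreserving : MeasurePreserving S P P
  equivariant : ∀ A : Set X, MeasurableSet A → ∀ᵐ ω ∂P, (N (S ω)).1 A = (N ω).1 (T ⁻¹' A)

/-- `N` is a Poisson point process of intensity `ν`: its values on disjoint measurable sets
`A_1, …, A_k` with `0 < ν (A_i) < ∞` are independent and Poisson distributed with parameters
`ν (A_i)`. -/
structure IsPoissonProcess (ν : Measure X) (P : Measure Ω) (N : Ω → Config X) : Prop where
  measurable : Measurable N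
  poisson : ∀ k : ℕ, 1 ≤ k → ∀ A : Fin k → Set X,
    (∀ i, MeasurableSet (A i) ∧ 0 < ν (A i) ∧ ν (A i) < ∞) →
    (∀ i j, i ≠ j → Disjoint (A i) (A j)) →
      iIndepFun (fun (i : Fin k) (ω : Ω) => (N ω).1 (A i)) P ∧
      ∀ i, P.map (fun ω => (N ω).1 (A i)) =
        (poissonMeasure (ν (A i)).toNNReal).map fun m : ℕ => (m : ℝ≥0∞)

/-- `N₁` and `N₂` are dissociated: for every `k ∈ ℤ`, almost surely `N₁` and `N₂ ∘ S ^ k` have no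
common points. -/
def Dissociated (P : Measure Ω) (S : Ω ≃ᵐ Ω) (N₁ N₂ : Ω → Config X) : Prop :=
  ∀ k : ℤ, ∀ᵐ ω ∂P, ∀ x : X, ¬((N₁ ω).1 {x} = 1 ∧ (N₂ (zpowMap S k ω)).1 {x} = 1)

end Processes

end TPoint

end

/-!
Independence is tested on void events. The events `{N A = 0}`, `A` bounded and measurable, form a
π-system generating the sigma-algebra of the space of configurations
(`TPoint.generateFrom_voidEvents`), so it suffices that the events `{N_i A_i = 0}`, one for each
process, are independent. If the sets `A_i` are cut into the cells `A_i ∩ c` of a fine finite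
partition, each cell contains at most one point, and the indicator of `⋂ i, {N_i A_i = 0}` becomes
`∏ i, ∏ c, (1 - N_i (A_i ∩ c))`, dominated by `exp (∑ i, N_i A_i)`, which is integrable because
Poisson variables have exponential moments. Expanding the product, only the joint moments
`E[∏ j, N_{l j} (A_j)]` are needed, for sets `A_j` which are disjoint whenever they are attached to
the same process, and the claim is that such a moment equals `∏ j, α_{l j} μ(A_j)`
(`TPoint.DissociatedPoisson.integral_prod_fin_eq`).

These moments are the values on boxes of the moment measure `σ` on `X ^ n`, the mean of the product
measures `N_{l 1} ⊗ ⋯ ⊗ N_{l n}`. It is boundedly finite, invariant under `T × ⋯ × T`, and its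
marginals are absolutely continuous with respect to `μ`, so that (P2) describes its ergodic
components. Let `G` be the set of tuples whose entries lie on distinct orbits. A component
`m_π^κ` for which `π` is not the partition into singletons gives no mass to `G`, and the only other
one is `μ^{⊗ n}`, to which `G` is conull because `μ` has no atoms. Hence `σ (A ∩ G)` is a constant
multiple of `∏ j, μ(A_j)`, for `A = ∏ j, A_j`
(`TPoint.PropertyP2.exists_eq_mul_prod`). Moreover, for the boxes at hand,
`σ (A) = σ (A ∩ G)`: almost surely two points on one orbit, each belonging to one of the processes,
are the same point of the same process (`TPoint.DissociatedPoisson.ae_orbit`). For distinct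
processes this is dissociation; for a single Poisson process it holds because off the diagonal its
second moment measure is proportional to `μ ⊗ μ`, which does not charge graphs.

The constant is found by induction on `n`. When the first set is replaced by sets of measure
`s ^ 2 → ∞`, its number of points deviates from the mean `α s ^ 2` by the order of `s` only, so it
contributes the factor `α` (`TPoint.DissociatedPoisson.abs_integral_mul_count_sub_le`).
-/

noncomputable section

namespace TPoint

/-! ### Dissecting partitions -/

section Partition

open MeasurableSpace Filter

variable {X : Type*} [MeasurableSpace X] [CountablyGenerated X]

/-- The cells of the `n`-th partition of a dissecting sequence of finite measurable partitions. -/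
def cells (X : Type*) [MeasurableSpace X] [CountablyGenerated X] (n : ℕ) : Finset (Set X) :=
  (finite_countablePartition X n).toFinset

theorem mem_cells {n : ℕ} {c : Set X} : c ∈ cells X n ↔ c ∈ countablePartition X n :=
  (finite_countablePartition X n).mem_toFinset

theorem measurableSet_of_mem_cells {n : ℕ} {c : Set X} (hc : c ∈ cells X n) : MeasurableSet c :=
  measurableSet_countablePartition n (mem_cells.1 hc)

theorem disjoint_cells {n : ℕ} {c d : Set X} (hc : c ∈ cells X n) (hd : d ∈ cells X n)
    (h : c ≠ d) : Disjoint c d :=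
  disjoint_countablePartition (mem_cells.1 hc) (mem_cells.1 hd) h

theorem measure_eq_sum_cells (m : Measure X) (n : ℕ) {A : Set X} (hA : MeasurableSet A) :
    m A = ∑ c ∈ cells X n, m (A ∩ c) := by
  have hU : A = ⋃ c ∈ cells X n, A ∩ c := by
    rw [← Set.inter_iUnion₂]
    have := sUnion_countablePartition X n
    rw [sUnion_eq_biUnion] at this
    simp only [mem_cells, this, inter_univ]
  conv_lhs => rw [hU]
  refine measure_biUnion_finset ?_ fun c hc => hA.inter (measurableSet_of_mem_cells hc)
  intro c hc d hd h
  exact (disjoint_cells hc hd h).mono inter_subset_right inter_subset_right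

/-- The partitions are nested: a cell of the coarser one contains both or none of two points in
a cell of the finer one. -/
theorem mem_iff_of_mem_cell {n m : ℕ} (hmn : m ≤ n) {c d : Set X} (hc : c ∈ cells X n)
    (hd : d ∈ cells X m) {x y : X} (hx : x ∈ c) (hy : y ∈ c) : x ∈ d ↔ y ∈ d := by
  have hle : generateFrom (countablePartition X m) ≤ generateFrom (countablePartition X n) :=
    monotone_nat_of_le_succ (f := fun n => generateFrom (countablePartition X n))
      (generateFrom_countablePartition_le_succ X) hmn
  obtain ⟨S, hS, rfl⟩ := (measurableSet_generateFrom_countablePartition_iff n d).1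
    (hle _ (measurableSet_generateFrom (mem_cells.1 hd)))
  have key : ∀ {z}, z ∈ c → (z ∈ ⋃₀ (S : Set (Set X)) ↔ c ∈ S) := by
    intro z hz
    refine ⟨fun ⟨t, ht, hzt⟩ => ?_, fun h => ⟨c, h, hz⟩⟩
    have : t = c := by
      by_contra hne
      exact Set.disjoint_left.1 (disjoint_cells (mem_cells.2 (hS ht)) hc hne) hzt hz
    exact this ▸ ht
  rw [key hx, key hy]

/-- The partitions eventually separate any two given points. -/
theorem eventually_separated [MeasurableSingletonClass X] {x y : X} (hxy : x ≠ y) :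
    ∀ᶠ n in atTop, ∀ c ∈ cells X n, x ∈ c → y ∉ c := by
  obtain ⟨m, d, hd, hxd⟩ : ∃ m, ∃ d ∈ cells X m, ¬ (x ∈ d ↔ y ∈ d) := by
    by_contra! hcon
    have key : ∀ A, MeasurableSet A → (x ∈ A ↔ y ∈ A) := by
      intro A hA
      rw [← generateFrom_iUnion_countablePartition X] at hA
      induction A, hA using generateFrom_induction with
      | hC u hu _ =>
        obtain ⟨n, hn⟩ := mem_iUnion.1 hu
        exact hcon n u (mem_cells.2 hn)
      | empty => simp
      | compl u _ hu => simp [hu]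
      | iUnion f _ h => simp [h]
    exact hxy ((key {x} (measurableSet_singleton x)).1 rfl).symm
  filter_upwards [eventually_ge_atTop m] with n hn c hc hx hy
  exact hxd (mem_iff_of_mem_cell hn hc hd hx hy)

end Partition

/-! ### Simple counting measures -/

section Counting

open MeasurableSpace Filter

variable {X : Type*} [MetricSpace X] [MeasurableSpace X]

theorem Config.exists_encard (ξ : Config X) :
    ∃ s : Set X, s.Countable ∧ ∀ A, MeasurableSet A → ξ.1 A = (s ∩ A).encard := by
  obtain ⟨ξ, -, s, hs, rfl⟩ := ξ
  refine ⟨s, hs, fun A hA => ?_⟩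
  simp only [Measure.sum_apply _ hA, Measure.dirac_apply' _ hA]
  rw [tsum_subtype s (A.indicator 1), ← ENNReal.tsum_set_one, tsum_subtype (s ∩ A) fun _ => 1]
  congr 1 with x
  by_cases h1 : x ∈ s <;> by_cases h2 : x ∈ A <;> simp [h1, h2]

/-- The set of points of a configuration `ξ`, encoded as the set of its atoms of mass one. -/
def Config.points (ξ : Config X) : Set X := {x | ξ.1 {x} = 1}

theorem measurable_eval {A : Set X} (hA : MeasurableSet A) :
    Measurable fun ξ : Config X => ξ.1 A :=
  (Measure.measurable_coe hA).comp measurable_subtype_coe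

/-- The void events `{ξ A = 0}`, with `A` bounded and measurable. -/
def voidEvents (X : Type*) [MetricSpace X] [MeasurableSpace X] : Set (Set (Config X)) :=
  {D | ∃ A : Set X, MeasurableSet A ∧ Bornology.IsBounded A ∧ D = {ξ | ξ.1 A = 0}}

theorem isPiSystem_voidEvents : IsPiSystem (voidEvents X) := by
  rintro _ ⟨A, hA, hAb, rfl⟩ _ ⟨B, hB, hBb, rfl⟩ -
  refine ⟨A ∪ B, hA.union hB, hAb.union hBb, ?_⟩
  ext ξ
  simp [measure_union_null_iff]

variable [SecondCountableTopology X]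

theorem BoundedlyFinite.sigmaFinite {m : Measure X} (hm : BoundedlyFinite m) : SigmaFinite m := by
  have : IsLocallyFiniteMeasure m :=
    ⟨fun x => ⟨Metric.ball x 1, Metric.ball_mem_nhds x one_pos, hm _ Metric.isBounded_ball⟩⟩
  infer_instance

instance (ξ : Config X) : SigmaFinite ξ.1 := ξ.2.1.sigmaFinite

variable [BorelSpace X]

theorem Config.points_eq {ξ : Config X} {s : Set X}
    (hs : ∀ A, MeasurableSet A → ξ.1 A = (s ∩ A).encard) : ξ.points = s := by
  ext x
  simp only [Config.points, mem_ofPred_eq, hs _ (measurableSet_singleton x)]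
  by_cases h : x ∈ s
  · rw [inter_eq_right.2 (singleton_subset_iff.2 h)]; simp [h]
  · rw [inter_singleton_eq_empty.2 h]; simp [h]

theorem Config.countable_points (ξ : Config X) : ξ.points.Countable := by
  obtain ⟨s, hs, h⟩ := ξ.exists_encard
  rwa [points_eq h]

theorem Config.apply_eq (ξ : Config X) {A : Set X} (hA : MeasurableSet A) :
    ξ.1 A = (ξ.points ∩ A).encard := by
  obtain ⟨s, hs, h⟩ := ξ.exists_encard
  rw [points_eq h, h A hA]

theorem Config.ae_mem_points (ξ : Config X) : ∀ᵐ x ∂ξ.1, x ∈ ξ.points := by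
  have hm : MeasurableSet ξ.points := ξ.countable_points.measurableSet
  rw [ae_iff, show {a | a ∉ ξ.points} = ξ.pointsᶜ from rfl, ξ.apply_eq hm.compl]
  simp

theorem Config.eq_zero_or_one_le (ξ : Config X) {A : Set X} (hA : MeasurableSet A) :
    ξ.1 A = 0 ∨ 1 ≤ ξ.1 A := by
  rw [ξ.apply_eq hA]
  rcases eq_empty_or_nonempty (ξ.points ∩ A) with h | h
  · simp [h]
  · right
    exact_mod_cast one_le_encard_iff_nonempty.2 h

/-- On a bounded set, all cells of a fine enough partition contain at most one point. -/
theorem Config.eventually_cells_le_one (ξ : Config X) {A : Set X} (hA : MeasurableSet A)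
    (hb : Bornology.IsBounded A) : ∀ᶠ n in atTop, ∀ c ∈ cells X n, ξ.1 (A ∩ c) ≤ 1 := by
  have hfin : (ξ.points ∩ A).Finite := by
    have h := ξ.2.1 A hb
    rw [ξ.apply_eq hA] at h
    exact encard_lt_top_iff.1 (by simpa using h)
  have h : ∀ᶠ n in atTop, ∀ x ∈ ξ.points ∩ A, ∀ y ∈ ξ.points ∩ A, x ≠ y →
      ∀ c ∈ cells X n, x ∈ c → y ∉ c := by
    rw [eventually_all_finite hfin]
    intro x _
    rw [eventually_all_finite hfin]
    intro y _
    by_cases hxy : x = y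
    · simp [hxy]
    · filter_upwards [eventually_separated hxy] with n hn _ using hn
  filter_upwards [h] with n hn c hc
  rw [ξ.apply_eq (hA.inter (measurableSet_of_mem_cells hc))]
  have : (ξ.points ∩ (A ∩ c)).encard ≤ 1 := by
    rw [encard_le_one_iff]
    rintro x y ⟨hx, hxA, hxc⟩ ⟨hy, hyA, hyc⟩
    by_contra hxy
    exact hn x ⟨hx, hxA⟩ y ⟨hy, hyA⟩ hxy c hc hxc hyc
  exact_mod_cast this

/-- The number of occupied cells of a partition increases to the number of points. -/
theorem Config.apply_eq_iSup (ξ : Config X) {A : Set X} (hA : MeasurableSet A)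
    (hb : Bornology.IsBounded A) :
    ξ.1 A = ⨆ n, ∑ c ∈ cells X n, {ξ : Config X | ξ.1 (A ∩ c) = 0}ᶜ.indicator 1 ξ := by
  have hle : ∀ n, ∀ c ∈ cells X n,
      ({ξ : Config X | ξ.1 (A ∩ c) = 0}ᶜ.indicator 1 ξ : ℝ≥0∞) ≤ ξ.1 (A ∩ c) := by
    intro n c hc
    rcases ξ.eq_zero_or_one_le (hA.inter (measurableSet_of_mem_cells hc)) with h | h
    · simp [h]
    · exact (indicator_le_self' (by simp) ξ).trans h
  refine le_antisymm ?_ (iSup_le fun n => ?_)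
  · obtain ⟨n, hn⟩ := (ξ.eventually_cells_le_one hA hb).exists
    refine le_trans ?_ (le_iSup _ n)
    rw [measure_eq_sum_cells ξ.1 n hA]
    refine Finset.sum_le_sum fun c hc => ?_
    by_cases h : ξ.1 (A ∩ c) = 0
    · simp [h]
    · rw [indicator_of_mem (by exact h)]
      exact hn c hc
  · rw [measure_eq_sum_cells ξ.1 n hA]
    exact Finset.sum_le_sum (hle n)

/-- Void events determine a simple point process: they generate its sigma-algebra. -/
theorem generateFrom_voidEvents [Nonempty X] :
    (inferInstance : MeasurableSpace (Config X)) = generateFrom (voidEvents X) := by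
  refine le_antisymm ?_ (generateFrom_le ?_)
  · refine Measurable.comap_le (m₁ := generateFrom (voidEvents X)) ?_
    have hbdd : ∀ A : Set X, MeasurableSet A → Bornology.IsBounded A →
        Measurable[generateFrom (voidEvents X)] fun ξ : Config X => ξ.1 A := by
      intro A hA hb
      simp_rw [fun ξ : Config X => ξ.apply_eq_iSup hA hb]
      refine Measurable.iSup fun n => ?_
      refine Finset.measurable_fun_sum _ fun c hc => ?_
      refine Measurable.indicator measurable_const ?_
      exact MeasurableSet.compl (measurableSet_generateFrom
        ⟨A ∩ c, hA.inter (measurableSet_of_mem_cells hc), hb.subset inter_subset_left, rfl⟩)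
    refine Measure.measurable_of_measurable_coe _
      fun A hA => ?_
    obtain ⟨x₀⟩ := ‹Nonempty X›
    have hsup : ∀ ξ : Config X, ξ.1 A = ⨆ r : ℕ, ξ.1 (A ∩ Metric.ball x₀ r) := by
      intro ξ
      rw [← Monotone.measure_iUnion, ← inter_iUnion, Metric.iUnion_ball_nat, inter_univ]
      exact fun a b hab => inter_subset_inter_right _
        (Metric.ball_subset_ball (by exact_mod_cast hab))
    simp_rw [hsup]
    exact Measurable.iSup fun r =>
      hbdd _ (hA.inter measurableSet_ball) (Metric.isBounded_ball.subset inter_subset_right)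
  · rintro _ ⟨A, hA, -, rfl⟩
    exact measurable_eval hA (measurableSet_singleton 0)

end Counting

/-! ### Moments of Poisson variables -/

section Poisson

theorem lintegral_poissonMeasure (r : ℝ≥0) (f : ℕ → ℝ≥0∞) :
    ∫⁻ n, f n ∂poissonMeasure r =
      ∑' n : ℕ, ENNReal.ofReal (Real.exp (-r) * r ^ n / n.factorial) * f n := by
  simp [poissonMeasure, lintegral_sum_measure, lintegral_smul_measure]

/-- The size-biased Poisson law is the Poisson law shifted by one. -/
theorem lintegral_cast_mul_poissonMeasure (r : ℝ≥0) (f : ℕ → ℝ≥0∞) :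
    ∫⁻ n, n * f n ∂poissonMeasure r = r * ∫⁻ n, f (n + 1) ∂poissonMeasure r := by
  rw [lintegral_poissonMeasure, lintegral_poissonMeasure, tsum_eq_zero_add' ENNReal.summable,
    ← ENNReal.tsum_mul_left]
  simp only [Nat.cast_zero, zero_mul, mul_zero, zero_add]
  congr 1 with n
  have : ENNReal.ofReal (Real.exp (-r) * r ^ (n + 1) / (n + 1).factorial) * ((n + 1 : ℕ) : ℝ≥0∞) =
      r * ENNReal.ofReal (Real.exp (-r) * r ^ n / n.factorial) := by
    rw [← ENNReal.ofReal_natCast (n + 1), ← ENNReal.ofReal_coe_nnreal (p := r),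
      ← ENNReal.ofReal_mul (by positivity), ← ENNReal.ofReal_mul (by positivity)]
    congr 1
    push_cast [Nat.factorial_succ]
    field_simp
    ring
  rw [← mul_assoc, this, mul_assoc]

theorem integrable_exp_mul_poissonMeasure (r : ℝ≥0) (t : ℝ) :
    Integrable (fun n : ℕ => Real.exp (t * n)) (poissonMeasure r) := by
  rw [integrable_poissonMeasure_iff]
  have := (Real.summable_pow_div_factorial (r * Real.exp t)).mul_left (Real.exp (-r))
  refine this.congr fun n => ?_
  rw [Real.norm_of_nonneg (Real.exp_pos _).le, mul_pow, ← Real.exp_nat_mul, mul_comm t]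
  ring

variable {X Ω : Type*} [MetricSpace X] [MeasurableSpace X] [MeasurableSpace Ω]

/-- The law of the number of points of a Poisson process in a set of finite intensity. -/
theorem IsPoissonProcess.law {ν : Measure X} {P : Measure Ω} {N : Ω → Config X}
    (h : IsPoissonProcess ν P N) {A : Set X} (hA : MeasurableSet A) (h0 : 0 < ν A)
    (hfin : ν A < ∞) :
    P.map (fun ω => (N ω).1 A) =
      (poissonMeasure (ν A).toNNReal).map fun m : ℕ => (m : ℝ≥0∞) :=
  (h.poisson 1 le_rfl (fun _ => A) (fun _ => ⟨hA, h0, hfin⟩)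
    (fun i j hij => absurd (Subsingleton.elim i j) hij)).2 0

theorem lintegral_comp_of_map_poisson {P : Measure Ω} {Y : Ω → ℝ≥0∞} (hY : Measurable Y) {r : ℝ≥0}
    (h : P.map Y = (poissonMeasure r).map fun m : ℕ => (m : ℝ≥0∞)) {f : ℝ≥0∞ → ℝ≥0∞}
    (hf : Measurable f) : ∫⁻ ω, f (Y ω) ∂P = ∫⁻ n : ℕ, f n ∂poissonMeasure r := by
  rw [← lintegral_map hf hY, h, lintegral_map hf .of_discrete]

variable {ν : Measure X} {P : Measure Ω} [IsProbabilityMeasure P] {N : Ω → Config X}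

theorem IsPoissonProcess.lintegral_eq
    (h : IsPoissonProcess ν P N)
    (hnull : ∀ A : Set X, MeasurableSet A → ν A = 0 → ∀ᵐ ω ∂P, (N ω).1 A = 0)
    {A : Set X} (hA : MeasurableSet A) (hfin : ν A < ∞) :
    ∫⁻ ω, (N ω).1 A ∂P = ν A := by
  rcases eq_or_ne (ν A) 0 with h0 | h0
  · rw [lintegral_congr_ae (hnull A hA h0), h0]; simp
  · rw [lintegral_comp_of_map_poisson (Y := fun ω => (N ω).1 A)
      ((measurable_eval hA).comp h.measurable)
      (h.law hA h0.bot_lt hfin) (f := fun y => y) measurable_id]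
    have := lintegral_cast_mul_poissonMeasure (ν A).toNNReal fun _ => 1
    simp only [mul_one, lintegral_one, measure_univ] at this
    rw [this, ENNReal.coe_toNNReal hfin.ne]

theorem IsPoissonProcess.lintegral_sq_eq
    (h : IsPoissonProcess ν P N)
    (hnull : ∀ A : Set X, MeasurableSet A → ν A = 0 → ∀ᵐ ω ∂P, (N ω).1 A = 0)
    {A : Set X} (hA : MeasurableSet A) (hfin : ν A < ∞) :
    ∫⁻ ω, (N ω).1 A ^ 2 ∂P = ν A * (ν A + 1) := by
  rcases eq_or_ne (ν A) 0 with h0 | h0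
  · have : (fun ω => (N ω).1 A ^ 2) =ᵐ[P] fun _ => 0 := by
      filter_upwards [hnull A hA h0] with ω hω
      simp [hω]
    rw [lintegral_congr_ae this, h0]; simp
  · rw [lintegral_comp_of_map_poisson (Y := fun ω => (N ω).1 A)
      ((measurable_eval hA).comp h.measurable)
      (h.law hA h0.bot_lt hfin) (f := fun y => y ^ 2) (measurable_id.pow_const 2)]
    have h1 := lintegral_cast_mul_poissonMeasure (ν A).toNNReal fun _ => 1
    have h2 := lintegral_cast_mul_poissonMeasure (ν A).toNNReal fun n => n
    simp only [mul_one, lintegral_one, measure_univ] at h1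
    simp only [sq]
    rw [h2]
    simp only [Nat.cast_add, Nat.cast_one]
    rw [lintegral_add_right _ measurable_const, h1, lintegral_one, measure_univ,
      ENNReal.coe_toNNReal hfin.ne]

theorem IsPoissonProcess.integrable_exp
    (h : IsPoissonProcess ν P N)
    (hnull : ∀ A : Set X, MeasurableSet A → ν A = 0 → ∀ᵐ ω ∂P, (N ω).1 A = 0)
    {A : Set X} (hA : MeasurableSet A) (hfin : ν A < ∞)
    (t : ℝ) : Integrable (fun ω => Real.exp (t * ((N ω).1 A).toReal)) P := by
  rcases eq_or_ne (ν A) 0 with h0 | h0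
  · refine (integrable_const (1 : ℝ)).congr ?_
    filter_upwards [hnull A hA h0] with ω hω
    simp [hω]
  · have hm : Measurable fun y : ℝ≥0∞ => Real.exp (t * y.toReal) := by fun_prop
    have hN : Measurable fun ω => (N ω).1 A := (measurable_eval hA).comp h.measurable
    have : Integrable (fun y : ℝ≥0∞ => Real.exp (t * y.toReal)) (P.map fun ω => (N ω).1 A) := by
      rw [h.law hA h0.bot_lt hfin, integrable_map_measure hm.aestronglyMeasurable (by fun_prop)]
      exact (integrable_exp_mul_poissonMeasure _ t).congr (by simp [Function.comp_def])
    exact this.comp_measurable hN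

end Poisson

/-! ### Atoms and graphs -/

section Atoms

variable {X : Type*} [MetricSpace X] [MeasurableSpace X]

/-- An atom would return to itself by conservativity, and its finite orbit would carry all of the
infinite measure `μ` by ergodicity. -/
theorem nullSingletonClass_of_ergodic_of_conservative [MeasurableSingletonClass X] {μ : Measure X}
    {T : X → X} (hT : Function.Injective T) (hbdd : BoundedlyFinite μ) (hinf : μ univ = ⊤)
    (herg : Ergodic T μ) (hcons : Conservative T μ) : NullSingletonClass μ := by
  refine ⟨fun x => ?_⟩
  by_contra hx
  obtain ⟨y, rfl, m, hm, hy⟩ := hcons.exists_mem_iterate_mem'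
    (measurableSet_singleton x) hx
  have hper : Function.IsPeriodicPt T m y := hy
  set O : Set X := (fun j => T^[j] y) '' Set.Iio m with hO
  have hfin : O.Finite := (Set.finite_Iio m).image _
  have hyO : y ∈ O := ⟨0, Nat.pos_of_ne_zero hm, rfl⟩
  have hinv : T ⁻¹' O = O := by
    ext z
    constructor
    · rintro ⟨j, hj, hjz⟩
      rcases j with _ | j
      · refine ⟨m - 1, by simp only [mem_Iio]; omega, hT ?_⟩
        have : T^[m - 1 + 1] y = T z := by
          rw [Nat.sub_add_cancel (Nat.pos_of_ne_zero hm), hper.eq]; exact hjz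
        rwa [Function.iterate_succ_apply'] at this
      · refine ⟨j, by simp only [mem_Iio] at hj ⊢; omega, hT ?_⟩
        simpa only [Function.iterate_succ_apply'] using hjz
    · rintro ⟨j, hj, rfl⟩
      simp only [mem_preimage, ← Function.iterate_succ_apply' T]
      rcases Nat.lt_or_ge (j + 1) m with h | h
      · exact ⟨j + 1, h, rfl⟩
      · have : j + 1 = m := le_antisymm hj h
        rw [Nat.succ_eq_add_one, this, hper.eq]
        exact hyO
  have hOb : μ O < ⊤ := hbdd O hfin.isBounded
  rcases herg.toPreErgodic.measure_self_or_compl_eq_zero hfin.measurableSet hinv with h | h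
  · exact hx (measure_mono_null (singleton_subset_iff.2 hyO) h)
  · have : μ univ ≤ μ O + μ Oᶜ := by
      rw [← union_compl_self O]; exact measure_union_le _ _
    rw [hinf, h, add_zero] at this
    exact hOb.not_ge this

variable [SecondCountableTopology X] [BorelSpace X]

theorem measurableSet_graph {n : ℕ} {f : X → X} (hf : Measurable f) (i j : Fin n) :
    MeasurableSet {x : Fin n → X | x i = f (x j)} :=
  measurableSet_eq_fun (measurable_pi_apply i) (hf.comp (measurable_pi_apply j))

/-- A graph is a null set for a product of measures without atoms. -/
theorem pi_graph_eq_zero {n : ℕ} (m : Fin n → Measure X) [∀ i, SigmaFinite (m i)]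
    [∀ i, NullSingletonClass (m i)] {f : X → X} (hf : Measurable f) {i j : Fin n} (hij : j ≠ i) :
    Measure.pi m {x | x i = f (x j)} = 0 := by
  cases n with
  | zero => exact i.elim0
  | succ n =>
    obtain ⟨j, rfl⟩ := Fin.exists_succAbove_eq hij
    have hs : MeasurableSet {p : X × (Fin n → X) | p.1 = f (p.2 j)} :=
      measurableSet_eq_fun measurable_fst (by fun_prop)
    have hpre : {x : Fin (n + 1) → X | x i = f (x (i.succAbove j))} =
        MeasurableEquiv.piFinSuccAbove (fun _ => X) i ⁻¹' {p | p.1 = f (p.2 j)} := rfl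
    rw [hpre, (measurePreserving_piFinSuccAbove m i).measure_preimage hs.nullMeasurableSet,
      Measure.prod_apply_symm hs]
    simp

end Atoms

/-! ### Moment measures -/

section Moment

theorem iUnion_pi_ball {X : Type*} [MetricSpace X] (x₀ : X) (n : ℕ) :
    ⋃ r : ℕ, Set.pi univ (fun _ : Fin n => Metric.ball x₀ (r : ℝ)) = univ := by
  rw [Set.iUnion_univ_pi_of_monotone fun _ a b hab =>
    Metric.ball_subset_ball (by exact_mod_cast hab)]
  simp [Metric.iUnion_ball_nat]

variable {X Ω : Type*} [MetricSpace X] [SecondCountableTopology X] [MeasurableSpace X]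
  [BorelSpace X] [MeasurableSpace Ω]

/-- A product of random configurations is a random measure. Its restrictions to bounded boxes are
finite, so that their measurability can be checked on the π-system of boxes. -/
theorem measurable_pi_config [Nonempty X] {n : ℕ} {M : Fin n → Ω → Config X}
    (hM : ∀ j, Measurable (M j)) : Measurable fun ω => Measure.pi fun j => (M j ω).1 := by
  obtain ⟨x₀⟩ := ‹Nonempty X›
  set B : ℕ → Set (Fin n → X) := fun r => Set.pi univ fun _ => Metric.ball x₀ (r : ℝ) with hB
  have hBm : ∀ r, MeasurableSet (B r) := fun r => .univ_pi fun _ => measurableSet_ball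
  have hbox : ∀ A : Fin n → Set X, (∀ j, MeasurableSet (A j)) →
      Measurable fun ω => Measure.pi (fun j => (M j ω).1) (Set.pi univ A) := by
    intro A hA
    simp_rw [Measure.pi_pi]
    exact Finset.measurable_fun_prod _ fun j _ => (measurable_eval (hA j)).comp (hM j)
  have hr : ∀ r, Measurable fun ω => (Measure.pi fun j => (M j ω).1).restrict (B r) := by
    intro r
    have : ∀ ω, IsFiniteMeasure ((Measure.pi fun j => (M j ω).1).restrict (B r)) := by
      refine fun ω => ⟨?_⟩
      rw [Measure.restrict_apply_univ, hB, Measure.pi_pi]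
      exact ENNReal.prod_lt_top fun j _ => (M j ω).2.1 _ Metric.isBounded_ball
    refine Measurable.measure_of_isPiSystem generateFrom_pi.symm isPiSystem_pi ?_ ?_
    · rintro _ ⟨A, hA, rfl⟩
      have hA' : ∀ j, MeasurableSet (A j) := fun j => hA j (mem_univ j)
      simp_rw [Measure.restrict_apply (MeasurableSet.univ_pi hA'), hB, ← Set.pi_inter_distrib]
      exact hbox _ fun j => (hA' j).inter measurableSet_ball
    · simp_rw [Measure.restrict_apply_univ]
      exact hbox _ fun j => measurableSet_ball
  refine Measure.measurable_of_measurable_coe _ fun s hs => ?_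
  have hsup : ∀ ω, Measure.pi (fun j => (M j ω).1) s =
      ⨆ r, (Measure.pi fun j => (M j ω).1).restrict (B r) s := by
    intro ω
    simp_rw [Measure.restrict_apply hs]
    rw [← Monotone.measure_iUnion, ← inter_iUnion, iUnion_pi_ball, inter_univ]
    exact fun a b hab => inter_subset_inter_right _
      (Set.pi_mono fun _ _ => Metric.ball_subset_ball (by exact_mod_cast hab))
  simp_rw [hsup]
  exact Measurable.iSup fun r => (Measure.measurable_coe hs).comp (hr r)

/-- The joint moment measure of finitely many point processes: its value on a box
`A_1 × ⋯ × A_n` is the expectation of `M_1(A_1) ⋯ M_n(A_n)`, see `momentMeasure_box`. -/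
def momentMeasure (P : Measure Ω) {n : ℕ} (M : Fin n → Ω → Config X) : Measure (Fin n → X) :=
  P.bind fun ω => Measure.pi fun j => (M j ω).1

theorem ae_mem_points_pi {n : ℕ} (ξ : Fin n → Config X) :
    ∀ᵐ x ∂Measure.pi fun j => (ξ j).1, ∀ j, x j ∈ (ξ j).points :=
  ae_all_iff.2 fun j => Measure.tendsto_eval_ae_ae.eventually (ξ j).ae_mem_points

variable [Nonempty X] {P : Measure Ω} {n : ℕ} {M : Fin n → Ω → Config X}

theorem momentMeasure_apply (hM : ∀ j, Measurable (M j)) {s : Set (Fin n → X)}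
    (hs : MeasurableSet s) :
    momentMeasure P M s = ∫⁻ ω, Measure.pi (fun j => (M j ω).1) s ∂P :=
  Measure.bind_apply hs (measurable_pi_config hM).aemeasurable

theorem momentMeasure_box (hM : ∀ j, Measurable (M j)) {A : Fin n → Set X}
    (hA : ∀ j, MeasurableSet (A j)) :
    momentMeasure P M (Set.pi univ A) = ∫⁻ ω, ∏ j, (M j ω).1 (A j) ∂P := by
  simp_rw [momentMeasure_apply hM (.univ_pi hA), Measure.pi_pi]

/-- A set which almost surely contains no tuple of points of the processes does not contribute to
the moment measure. -/
theorem momentMeasure_inter_of_ae (hM : ∀ j, Measurable (M j)) {s G : Set (Fin n → X)}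
    (hs : MeasurableSet s) (hG : MeasurableSet G)
    (h : ∀ᵐ ω ∂P, ∀ x ∈ s, (∀ j, x j ∈ (M j ω).points) → x ∈ G) :
    momentMeasure P M s = momentMeasure P M (s ∩ G) := by
  rw [momentMeasure_apply hM hs, momentMeasure_apply hM (hs.inter hG)]
  refine lintegral_congr_ae ?_
  filter_upwards [h] with ω hω
  refine measure_congr ?_
  filter_upwards [ae_mem_points_pi fun j => M j ω] with x hx
  exact propext ⟨fun h => ⟨h, hω x h hx⟩, fun h => h.1⟩

theorem ae_notMem_of_momentMeasure_eq_zero (hM : ∀ j, Measurable (M j)) {s : Set (Fin n → X)}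
    (hs : MeasurableSet s) (h : momentMeasure P M s = 0) :
    ∀ᵐ ω ∂P, ∀ x ∈ s, ¬ ∀ j, x j ∈ (M j ω).points := by
  have hmeas : Measurable fun ω => Measure.pi (fun j => (M j ω).1) s :=
    (Measure.measurable_coe hs).comp (measurable_pi_config hM)
  rw [momentMeasure_apply hM hs, lintegral_eq_zero_iff hmeas] at h
  filter_upwards [h] with ω hω x hx hpt
  have h1 : Measure.pi (fun j => (M j ω).1) {x} = 1 := by
    rw [Measure.pi_singleton]
    exact Finset.prod_eq_one fun j _ => hpt j
  have h2 : Measure.pi (fun j => (M j ω).1) {x} = 0 :=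
    measure_mono_null (singleton_subset_iff.2 hx) hω
  rw [h1] at h2
  exact one_ne_zero h2

end Moment

/-! ### Points on a common orbit -/

section Orbit

open MeasurableSpace Filter

variable {X Ω : Type*} [MetricSpace X] [SecondCountableTopology X] [MeasurableSpace X]
  [BorelSpace X] [MeasurableSpace Ω]

theorem isPiSystem_iUnion_cells : IsPiSystem (⋃ n, countablePartition X n) := by
  have key : ∀ {m n : ℕ} {c d : Set X}, m ≤ n → c ∈ countablePartition X m →
      d ∈ countablePartition X n → (c ∩ d).Nonempty → c ∩ d = d := by
    rintro m n c d hmn hc hd ⟨x, hxc, hxd⟩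
    exact inter_eq_right.2 fun y hy =>
      (mem_iff_of_mem_cell hmn (mem_cells.2 hd) (mem_cells.2 hc) hxd hy).1 hxc
  intro c hc d hd hcd
  obtain ⟨m, hm⟩ := mem_iUnion.1 hc
  obtain ⟨n, hn⟩ := mem_iUnion.1 hd
  rcases le_total m n with h | h
  · rw [key h hm hn hcd]; exact hd
  · rw [inter_comm] at hcd ⊢
    rw [key h hn hm hcd]; exact hc

/-- The equivariance of a `T`-point process holds almost surely for all sets simultaneously. -/
theorem IsTPointProcess.ae_eq_map [Nonempty X] {T : X ≃ᵐ X} {μ : Measure X} {P : Measure Ω}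
    {S : Ω ≃ᵐ Ω} {N : Ω → Config X} (h : IsTPointProcess T μ P S N) :
    ∀ᵐ ω ∂P, (N (S ω)).1 = (N ω).1.map T := by
  obtain ⟨x₀⟩ := ‹Nonempty X›
  have hcount : (⋃ n, countablePartition X n).Countable :=
    countable_iUnion fun n => (finite_countablePartition X n).countable
  have h1 : ∀ᵐ ω ∂P, ∀ r : ℕ, ∀ c ∈ ⋃ n, countablePartition X n,
      (N (S ω)).1 (c ∩ Metric.ball x₀ r) = (N ω).1 (T ⁻¹' (c ∩ Metric.ball x₀ r)) := by
    refine ae_all_iff.2 fun r => (ae_ball_iff hcount).2 fun c hc => ?_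
    obtain ⟨n, hn⟩ := mem_iUnion.1 hc
    exact h.equivariant _ ((measurableSet_countablePartition n hn).inter measurableSet_ball)
  have h2 : ∀ᵐ ω ∂P, ∀ r : ℕ,
      (N (S ω)).1 (Metric.ball x₀ r) = (N ω).1 (T ⁻¹' (Metric.ball x₀ r)) :=
    ae_all_iff.2 fun r => h.equivariant _ measurableSet_ball
  filter_upwards [h1, h2] with ω hω1 hω2
  rw [Measure.ext_iff_of_iUnion_eq_univ (Metric.iUnion_ball_nat x₀)]
  intro r
  have : IsFiniteMeasure ((N (S ω)).1.restrict (Metric.ball x₀ r)) :=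
    ⟨by rw [Measure.restrict_apply_univ]; exact (N (S ω)).2.1 _ Metric.isBounded_ball⟩
  refine ext_of_generate_finite _ (generateFrom_iUnion_countablePartition X).symm
    isPiSystem_iUnion_cells ?_ ?_
  · intro c hc
    obtain ⟨n, hn⟩ := mem_iUnion.1 hc
    have hcm := measurableSet_countablePartition n hn
    rw [Measure.restrict_apply hcm, Measure.restrict_apply hcm, hω1 r c hc,
      Measure.map_apply T.measurable (hcm.inter measurableSet_ball)]
  · rw [Measure.restrict_apply_univ, Measure.restrict_apply_univ, hω2 r,
      Measure.map_apply T.measurable measurableSet_ball]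

theorem IsTPointProcess.ae_iterate_mem_points [Nonempty X] {T : X ≃ᵐ X} {μ : Measure X}
    {P : Measure Ω} {S : Ω ≃ᵐ Ω} {N : Ω → Config X} (h : IsTPointProcess T μ P S N) (m : ℕ) :
    ∀ᵐ ω ∂P, ∀ x ∈ (N ω).points, T^[m] x ∈ (N (S^[m] ω)).points := by
  induction m with
  | zero => simp
  | succ m ih =>
    filter_upwards [ih, (h.measurePreserving.iterate m).quasiMeasurePreserving.ae h.ae_eq_map]
      with ω h1 h2 x hx
    have := h1 x hx
    simp only [Config.points, mem_ofPred_eq, Function.iterate_succ_apply'] at this ⊢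
    rw [h2, Measure.map_apply T.measurable (measurableSet_singleton _)]
    have hpre : T ⁻¹' {T (T^[m] x)} = {T^[m] x} := by
      ext y; simp
    rw [hpre, this]

/-- A Poisson process whose intensity has no atoms does not charge the graph of a map, except at
fixed points: away from the diagonal, its second moment measure is the square of the intensity. -/
theorem IsPoissonProcess.ae_eq_of_mem_graph [Nonempty X] {ν : Measure X} [NullSingletonClass ν]
    {P : Measure Ω} [IsProbabilityMeasure P] {N : Ω → Config X} (hν : BoundedlyFinite ν)
    (h : IsPoissonProcess ν P N)
    (hnull : ∀ A : Set X, MeasurableSet A → ν A = 0 → ∀ᵐ ω ∂P, (N ω).1 A = 0)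
    {f : X → X} (hf : Measurable f) :
    ∀ᵐ ω ∂P, ∀ x ∈ (N ω).points, ∀ y ∈ (N ω).points, x = f y → x = y := by
  obtain ⟨x₀⟩ := ‹Nonempty X›
  have : SigmaFinite ν := hν.sigmaFinite
  have hprod : ∀ C : Fin 2 → Set X, (∀ j, MeasurableSet (C j)) → (∀ j, ν (C j) < ∞) →
      Disjoint (C 0) (C 1) →
      momentMeasure P (fun _ : Fin 2 => N) (Set.pi univ C) = ∏ j, ν (C j) := by
    intro C hC hfin hd
    rw [momentMeasure_box (fun _ => h.measurable) hC]
    simp only [Fin.prod_univ_two]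
    by_cases h0 : ∃ j, ν (C j) = 0
    · obtain ⟨j, hj⟩ := h0
      have h1 : ∫⁻ ω, (N ω).1 (C 0) * (N ω).1 (C 1) ∂P = ∫⁻ _, 0 ∂P := by
        refine lintegral_congr_ae ?_
        filter_upwards [hnull _ (hC j) hj] with ω hω
        fin_cases j <;> simp_all
      rw [h1, lintegral_zero]
      fin_cases j <;> simp_all
    · push Not at h0
      obtain ⟨hind, -⟩ := h.poisson 2 one_le_two C (fun i => ⟨hC i, (h0 i).bot_lt, hfin i⟩) (by
        intro i j hij
        fin_cases i <;> fin_cases j <;> simp_all [disjoint_comm])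
      have hN : ∀ j, Measurable fun ω => (N ω).1 (C j) := fun j =>
        (measurable_eval (hC j)).comp h.measurable
      have := lintegral_mul_eq_lintegral_mul_lintegral_of_indepFun (hN 0) (hN 1)
        (hind.indepFun zero_ne_one)
      simp only [Pi.mul_apply] at this
      rw [this, h.lintegral_eq hnull (hC 0) (hfin 0), h.lintegral_eq hnull (hC 1) (hfin 1)]
  have hnul : ∀ C : Fin 2 → Set X, (∀ j, MeasurableSet (C j)) → (∀ j, ν (C j) < ∞) →
      Disjoint (C 0) (C 1) →
      ∀ᵐ ω ∂P, ∀ x ∈ (N ω).points, ∀ y ∈ (N ω).points, x ∈ C 0 → y ∈ C 1 → x ≠ f y := by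
    intro C hC hfin hd
    have hpi : Measure.pi (fun j => ν.restrict (C j)) =
        (momentMeasure P fun _ : Fin 2 => N).restrict (Set.pi univ C) := by
      refine Measure.pi_eq fun s hs => ?_
      rw [Measure.restrict_apply (.univ_pi hs), ← Set.pi_inter_distrib,
        hprod _ (fun j => (hs j).inter (hC j))
          (fun j => (measure_mono inter_subset_right).trans_lt (hfin j))
          (hd.mono inter_subset_right inter_subset_right)]
      exact Finset.prod_congr rfl fun j _ => (Measure.restrict_apply (hs j)).symm
    have hg := measurableSet_graph hf (0 : Fin 2) 1
    have h0 := pi_graph_eq_zero (fun j => ν.restrict (C j)) hf (one_ne_zero (α := Fin 2))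
    rw [hpi, Measure.restrict_apply hg] at h0
    filter_upwards [ae_notMem_of_momentMeasure_eq_zero (fun _ => h.measurable)
      (hg.inter (.univ_pi hC)) h0] with ω hω x hx y hy hxC hyC hxy
    refine hω ![x, y] ⟨hxy, ?_⟩ ?_
    · intro j _
      fin_cases j
      exacts [hxC, hyC]
    · intro j
      fin_cases j
      exacts [hx, hy]
  have hall : ∀ᵐ ω ∂P, ∀ n r : ℕ, ∀ c ∈ countablePartition X n, ∀ d ∈ countablePartition X n,
      c ≠ d → ∀ x ∈ (N ω).points, ∀ y ∈ (N ω).points,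
        x ∈ c ∩ Metric.ball x₀ r → y ∈ d ∩ Metric.ball x₀ r → x ≠ f y := by
    refine ae_all_iff.2 fun n => ae_all_iff.2 fun r =>
      (ae_ball_iff (finite_countablePartition X n).countable).2 fun c hc =>
      (ae_ball_iff (finite_countablePartition X n).countable).2 fun d hd =>
      ae_all_iff.2 fun hcd => ?_
    have hm : ∀ e ∈ countablePartition X n, MeasurableSet (e ∩ Metric.ball x₀ r) := fun e he =>
      (measurableSet_countablePartition n he).inter measurableSet_ball
    have hb : ∀ e : Set X, ν (e ∩ Metric.ball x₀ r) < ∞ := fun e =>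
      hν _ (Metric.isBounded_ball.subset inter_subset_right)
    refine hnul ![c ∩ Metric.ball x₀ r, d ∩ Metric.ball x₀ r] ?_ ?_ ?_
    · intro j
      fin_cases j
      exacts [hm c hc, hm d hd]
    · intro j
      fin_cases j
      exacts [hb c, hb d]
    · exact (disjoint_countablePartition hc hd hcd).mono inter_subset_left inter_subset_left
  filter_upwards [hall] with ω hω x hx y hy hxy
  by_contra hne
  obtain ⟨n, hn⟩ := (eventually_separated hne).exists
  obtain ⟨r, hr⟩ := exists_nat_gt (max (dist x x₀) (dist y x₀))
  have hxr : x ∈ Metric.ball x₀ (r : ℝ) := (le_max_left _ _).trans_lt hr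
  have hyr : y ∈ Metric.ball x₀ (r : ℝ) := (le_max_right _ _).trans_lt hr
  refine hω n r _ (countablePartitionSet_mem n x) _ (countablePartitionSet_mem n y) ?_ x hx y hy
    ⟨mem_countablePartitionSet n x, hxr⟩ ⟨mem_countablePartitionSet n y, hyr⟩ hxy
  intro heq
  exact hn _ (mem_cells.2 (countablePartitionSet_mem n x)) (mem_countablePartitionSet n x)
    (heq ▸ mem_countablePartitionSet n y)

end Orbit

/-! ### Ergodic components on tuples with distinct orbits -/

section Components

variable {X : Type*} [MetricSpace X] [SecondCountableTopology X] [MeasurableSpace X] [BorelSpace X]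

/-- The tuples `x` none of whose entries is on the forward orbit of another entry; equivalently,
the entries of `x` have pairwise distinct orbits. -/
def distinctOrbits (T : X ≃ᵐ X) (n : ℕ) : Set (Fin n → X) :=
  {x | ∀ i j, j ≠ i → ∀ m : ℕ, x i ≠ T^[m] (x j)}

theorem measurableSet_distinctOrbits (T : X ≃ᵐ X) (n : ℕ) :
    MeasurableSet (distinctOrbits T n) := by
  have : distinctOrbits T n = ⋂ (i) (j) (_ : j ≠ i) (m : ℕ), {x | x i = T^[m] (x j)}ᶜ := by
    ext x; simp [distinctOrbits]
  rw [this]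
  exact .iInter fun i => .iInter fun j => .iInter fun _ => .iInter fun m =>
    (measurableSet_graph (T.measurable.iterate m) i j).compl

theorem pi_compl_distinctOrbits (T : X ≃ᵐ X) (μ : Measure X) [SigmaFinite μ]
    [NullSingletonClass μ] (n : ℕ) :
    Measure.pi (fun _ : Fin n => μ) (distinctOrbits T n)ᶜ = 0 := by
  refine measure_mono_null (t := ⋃ (i) (j) (_ : j ≠ i) (m : ℕ), {x | x i = T^[m] (x j)})
    (fun x hx => by simpa [distinctOrbits] using hx) ?_
  exact measure_iUnion_null fun i => measure_iUnion_null fun j => measure_iUnion_null fun h =>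
    measure_iUnion_null fun m => pi_graph_eq_zero _ (T.measurable.iterate m) h

theorem zpowMap_natCast_add {X : Type*} [MeasurableSpace X] (T : X ≃ᵐ X) (m : ℕ) (b : ℤ) (y : X) :
    zpowMap T (m + b) y = T^[m] (zpowMap T b y) := by
  rw [zpowMap, zpow_add, zpow_natCast, Equiv.Perm.mul_apply, Equiv.Perm.coe_pow]
  rfl

/-- If `i` and `j` share an atom of `π`, then `m_π^κ` lives on tuples whose `i`-th and `j`-th
entries are on the same orbit. -/
theorem partMeasure_distinctOrbits_eq_zero (T : X ≃ᵐ X) (μ : Measure X) {n : ℕ}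
    {π : Finpartition (Finset.univ : Finset (Fin n))} (κ : Fin n → ℤ) {i j : Fin n}
    (hij : i ≠ j) (h : atom π i = atom π j) :
    partMeasure T μ π κ (distinctOrbits T n) = 0 := by
  have hm : Measurable fun (x : {P : Finset (Fin n) // P ∈ π.parts} → X) (i : Fin n) =>
      zpowMap T (κ i) (x (atom π i)) :=
    measurable_pi_lambda _ fun i => (measurable_zpowMap T (κ i)).comp (measurable_pi_apply _)
  have key : ∀ i j : Fin n, j ≠ i → atom π i = atom π j → κ j ≤ κ i →
      ∀ x : {P : Finset (Fin n) // P ∈ π.parts} → X,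
        (fun i => zpowMap T (κ i) (x (atom π i))) ∉ distinctOrbits T n := by
    intro i j hij h hle x hx
    obtain ⟨m, hm⟩ := Int.eq_ofNat_of_zero_le (sub_nonneg.2 hle)
    refine hx i j hij m ?_
    have hκ : κ i = m + κ j := by rw [← hm]; ring
    rw [← zpowMap_natCast_add, ← h, ← hκ]
  rw [partMeasure, Measure.map_apply hm (measurableSet_distinctOrbits T n)]
  convert measure_empty (μ := Measure.pi fun _ : {P : Finset (Fin n) // P ∈ π.parts} => μ)
  refine eq_empty_of_forall_notMem fun x => ?_
  rcases le_total (κ j) (κ i) with hle | hle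
  · exact key i j hij.symm h hle x
  · exact key j i hij h.symm hle x

/-- For the partition into singletons, the only compatible `κ` is zero. -/
theorem partMeasure_eq_pi {X : Type*} [MeasurableSpace X] (T : X ≃ᵐ X) (μ : Measure X)
    [SigmaFinite μ] {n : ℕ} {π : Finpartition (Finset.univ : Finset (Fin n))} {κ : Fin n → ℤ}
    (hκ : IsCompatible π κ) (hπ : Function.Injective (atom π)) :
    partMeasure T μ π κ = Measure.pi fun _ => μ := by
  refine (Measure.pi_eq fun A hA => ?_).symm
  have hpart : ∀ i, π.part i = {i} := by
    intro i
    refine Finset.eq_singleton_iff_unique_mem.2 ⟨π.mem_part (Finset.mem_univ i), fun j hj => ?_⟩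
    refine hπ (Subtype.ext ?_)
    exact π.part_eq_of_mem (π.part_mem.2 (Finset.mem_univ i)) hj
  have hzero : κ = 0 := by
    funext i
    refine hκ {i} (hpart i ▸ π.part_mem.2 (Finset.mem_univ i)) i (Finset.mem_singleton_self i) ?_
    simp
  subst hzero
  rw [partMeasure_box T μ π 0 A hA]
  symm
  refine Finset.prod_bij (fun i _ => π.part i) (fun i _ => π.part_mem.2 (Finset.mem_univ i))
    (fun i _ j _ h => hπ (Subtype.ext h)) (fun P hP => ?_) (fun i _ => ?_)
  · obtain ⟨i, hi⟩ := π.nonempty_of_mem_parts hP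
    exact ⟨i, Finset.mem_univ i, π.part_eq_of_mem hP hi⟩
  · simp [hpart, zpowMap]

variable {T : X ≃ᵐ X} {μ : Measure X}

/-- Under (P2), a measure on `X ^ n` with absolutely continuous marginals is, on tuples with
distinct orbits, a multiple of the product measure. -/
theorem PropertyP2.exists_eq_mul_prod [SigmaFinite μ] [NullSingletonClass μ]
    (hbdd : BoundedlyFinite μ) (hP2 : PropertyP2 T μ) {n : ℕ} (hn : 1 ≤ n)
    {σ : Measure (Fin n → X)} (hσ : BoundedlyFinite σ) (hinv : MeasurePreserving (prodMap T n) σ σ)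
    (hmarg : ∀ i : Fin n, σ.map (fun x => x i) ≪ μ) :
    ∃ C : ℝ≥0∞, ∀ A : Fin n → Set X, (∀ j, MeasurableSet (A j)) →
      (∀ j, Bornology.IsBounded (A j)) →
      σ (Set.pi univ A ∩ distinctOrbits T n) = C * ∏ j, μ (A j) := by
  obtain ⟨-, Y, _, ρ, η, hdec, hη⟩ := hP2 n hn σ hσ hinv hmarg
  have hG := measurableSet_distinctOrbits T n
  have hex : ∀ᵐ y ∂ρ, ∃ c : ℝ≥0∞, ∀ A : Fin n → Set X,
      η y (Set.pi univ A ∩ distinctOrbits T n) = c * ∏ j, μ (A j) := by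
    filter_upwards [hη] with y hcomp
    obtain ⟨π, κ, c, hκ, -, hy⟩ := hcomp
    by_cases hπ : Function.Injective (atom π)
    · refine ⟨c, fun A => ?_⟩
      rw [hy, partMeasure_eq_pi T μ hκ hπ, Measure.smul_apply,
        measure_inter_conull (pi_compl_distinctOrbits T μ n), Measure.pi_pi]
      rfl
    · rw [Function.not_injective_iff] at hπ
      obtain ⟨i, j, hij, hne⟩ := hπ
      refine ⟨0, fun A => ?_⟩
      rw [zero_mul, hy, Measure.smul_apply, measure_mono_null inter_subset_right
        (partMeasure_distinctOrbits_eq_zero T μ κ hne hij), smul_zero]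
  -- the scalar `f y` need not be measurable: it is integrated against a finite constant only
  classical
  let f : Y → ℝ≥0∞ := fun y => if h : ∃ c : ℝ≥0∞, ∀ A : Fin n → Set X,
    η y (Set.pi univ A ∩ distinctOrbits T n) = c * ∏ j, μ (A j) then h.choose else 0
  refine ⟨∫⁻ y, f y ∂ρ, fun A hA hb => ?_⟩
  have hfin : ∏ j, μ (A j) ≠ ∞ := ENNReal.prod_ne_top fun j _ => (hbdd _ (hb j)).ne
  rw [hdec.eq_bind, Measure.bind_apply ((MeasurableSet.univ_pi hA).inter hG)
    hdec.measurable.aemeasurable, ← lintegral_mul_const' _ _ hfin]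
  refine lintegral_congr_ae ?_
  filter_upwards [hex] with y hy
  simp only [f, dif_pos hy]
  exact hy.choose_spec A

end Components

/-! ### Invariance of the moment measures -/

section Invariance

variable {X Ω : Type*} [MetricSpace X] [SecondCountableTopology X] [MeasurableSpace X]
  [BorelSpace X] [MeasurableSpace Ω] [Nonempty X] {T : X ≃ᵐ X} {μ : Measure X} {P : Measure Ω}
  {S : Ω ≃ᵐ Ω} {n : ℕ} {M : Fin n → Ω → Config X}

theorem boundedlyFinite_momentMeasure (hM : ∀ j, Measurable (M j))
    (hfin : ∀ A : Fin n → Set X, (∀ j, MeasurableSet (A j)) → (∀ j, Bornology.IsBounded (A j)) →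
      ∫⁻ ω, ∏ j, (M j ω).1 (A j) ∂P < ∞) : BoundedlyFinite (momentMeasure P M) := by
  intro B hB
  obtain ⟨x₀⟩ := ‹Nonempty X›
  have hb := Bornology.forall_isBounded_image_eval_iff.2 hB
  choose r hr using fun j => (hb j).subset_ball x₀
  have hsub : B ⊆ Set.pi univ fun j => Metric.ball x₀ (r j) :=
    fun x hx j _ => hr j ⟨x, hx, rfl⟩
  refine (measure_mono hsub).trans_lt ?_
  rw [momentMeasure_box hM fun j => measurableSet_ball]
  exact hfin _ (fun j => measurableSet_ball) fun j => Metric.isBounded_ball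

theorem measurePreserving_momentMeasure (hM : ∀ j, IsTPointProcess T μ P S (M j))
    (hS : MeasurePreserving S P P) (hσ : BoundedlyFinite (momentMeasure P M)) :
    MeasurePreserving (prodMap T n) (momentMeasure P M) (momentMeasure P M) := by
  have hT : Measurable (prodMap T n) :=
    measurable_pi_lambda _ fun j => T.measurable.comp (measurable_pi_apply j)
  have hMm : ∀ j, Measurable (M j) := fun j => (hM j).measurable
  refine ⟨hT, Eq.symm ?_⟩
  obtain ⟨x₀⟩ := id ‹Nonempty X›
  refine Measure.ext_of_generateFrom_of_iUnion _
    (fun r : ℕ => Set.pi univ fun _ => Metric.ball x₀ (r : ℝ)) generateFrom_pi.symm isPiSystem_pi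
    (iUnion_pi_ball x₀ n) (fun r => ⟨_, fun j _ => measurableSet_ball, rfl⟩) (fun r => ?_) ?_
  · refine (hσ _ ?_).ne
    exact Bornology.IsBounded.pi fun j => Metric.isBounded_ball
  · rintro _ ⟨A, hA, rfl⟩
    have hA' : ∀ j, MeasurableSet (A j) := fun j => hA j (mem_univ j)
    have hpre : prodMap T n ⁻¹' Set.pi univ A = Set.pi univ fun j => T ⁻¹' A j := rfl
    rw [Measure.map_apply hT (.univ_pi hA'), hpre, momentMeasure_box hMm hA',
      momentMeasure_box hMm fun j => T.measurable (hA' j)]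
    have hmeas : Measurable fun ω => ∏ j, (M j ω).1 (A j) :=
      Finset.measurable_fun_prod _ fun j _ => (measurable_eval (hA' j)).comp (hMm j)
    rw [← hS.lintegral_comp hmeas]
    refine lintegral_congr_ae ?_
    filter_upwards [ae_all_iff.2 fun j => (hM j).equivariant (A j) (hA' j)] with ω hω
    exact Finset.prod_congr rfl fun j _ => hω j

theorem map_momentMeasure_absolutelyContinuous (hM : ∀ j, IsTPointProcess T μ P S (M j))
    (i : Fin n) : (momentMeasure P M).map (fun x => x i) ≪ μ := by
  refine Measure.AbsolutelyContinuous.mk fun s hs h0 => ?_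
  rw [Measure.map_apply (measurable_pi_apply i) hs,
    momentMeasure_apply (fun j => (hM j).measurable) (measurable_pi_apply i hs)]
  rw [← lintegral_zero (μ := P)]
  refine lintegral_congr_ae ?_
  filter_upwards [(hM i).null s hs h0] with ω hω
  exact Measure.pi_eval_preimage_null _ hω

end Invariance

/-! ### Joint moments of dissociated Poisson processes -/

section JointMoments

open Filter Topology

variable {X Ω : Type*} [MetricSpace X] [MeasurableSpace X]

/-- The number of points of `N` in `A`, as a real number. It is meaningful for bounded `A`, where
`N` has finitely many points; otherwise an infinite number of points is recorded as zero. -/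
def count (N : Ω → Config X) (A : Set X) (ω : Ω) : ℝ := ((N ω).1 A).toReal

theorem count_nonneg (N : Ω → Config X) (A : Set X) (ω : Ω) : 0 ≤ count N A ω :=
  ENNReal.toReal_nonneg

theorem ofReal_count (N : Ω → Config X) {A : Set X} (hb : Bornology.IsBounded A) (ω : Ω) :
    ENNReal.ofReal (count N A ω) = (N ω).1 A :=
  ENNReal.ofReal_toReal ((N ω).2.1 A hb).ne

theorem prod_count_le_exp {k : ℕ} {N : Fin k → Ω → Config X} {ι : Type*} (U : Finset ι)
    (l : ι → Fin k) (A : ι → Set X) (ω : Ω) :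
    ∏ p ∈ U, count (N (l p)) (A p) ω ≤ Real.exp (∑ p ∈ U, count (N (l p)) (A p) ω) := by
  rw [Real.exp_sum]
  exact Finset.prod_le_prod (fun p _ => count_nonneg _ _ _) fun p _ =>
    (le_add_of_nonneg_right zero_le_one).trans (Real.add_one_le_exp _)

theorem intensity_lt_top {μ : Measure X} (hbdd : BoundedlyFinite μ) (a : ℝ≥0) {A : Set X}
    (hb : Bornology.IsBounded A) : (a • μ) A < ∞ := by
  rw [Measure.smul_apply, ENNReal.smul_def, smul_eq_mul]
  exact ENNReal.mul_lt_top ENNReal.coe_lt_top (hbdd _ hb)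

theorem zpowMap_natCast {Y : Type*} [MeasurableSpace Y] (R : Y ≃ᵐ Y) (m : ℕ) (y : Y) :
    zpowMap R m y = R^[m] y := by
  have := zpowMap_natCast_add R m 0 y
  simpa [zpowMap] using this

/-- Outside any bounded set there are bounded sets of arbitrarily large measure. -/
theorem exists_disjoint_isBounded_le_measure [BorelSpace X] [Nonempty X] {μ : Measure X}
    (hbdd : BoundedlyFinite μ) (hinf : μ univ = ⊤)
    {D : Set X} (hD : Bornology.IsBounded D) (K : ℝ≥0) :
    ∃ B, MeasurableSet B ∧ Bornology.IsBounded B ∧ Disjoint D B ∧ K ≤ μ B := by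
  obtain ⟨x₀⟩ := ‹Nonempty X›
  obtain ⟨R, hR⟩ := hD.subset_ball x₀
  have hmono : Monotone fun r : ℕ => Metric.ball x₀ (r : ℝ) := fun a b hab =>
    Metric.ball_subset_ball (by exact_mod_cast hab)
  have hlim := tendsto_measure_iUnion_atTop (μ := μ) hmono
  rw [Metric.iUnion_ball_nat, hinf] at hlim
  have hfin : μ (Metric.ball x₀ R) < ∞ := hbdd _ Metric.isBounded_ball
  obtain ⟨r, hr⟩ := (hlim.eventually (lt_mem_nhds
    (ENNReal.add_lt_top.2 ⟨hfin, ENNReal.coe_lt_top (r := K)⟩))).exists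
  refine ⟨Metric.ball x₀ r \ Metric.ball x₀ R, measurableSet_ball.diff measurableSet_ball,
    Metric.isBounded_ball.subset sdiff_subset, ?_, ?_⟩
  · exact Set.disjoint_left.2 fun x hx hx' => hx'.2 (hR hx)
  · refine le_trans ?_ le_measure_sdiff
    exact ENNReal.le_sub_of_add_le_left hfin.ne hr.le

theorem exists_pairwise_disjoint_isBounded [BorelSpace X] [Nonempty X] {μ : Measure X}
    (hbdd : BoundedlyFinite μ) (hinf : μ univ = ⊤) (n : ℕ) :
    ∃ A : Fin n → Set X, (∀ j, MeasurableSet (A j)) ∧ (∀ j, Bornology.IsBounded (A j)) ∧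
      (∀ j, μ (A j) ≠ 0) ∧ ∀ i j, i ≠ j → Disjoint (A i) (A j) := by
  induction n with
  | zero => exact ⟨fun i => i.elim0, fun i => i.elim0, fun i => i.elim0, fun i => i.elim0,
      fun i => i.elim0⟩
  | succ n ih =>
    obtain ⟨A, hA, hb, hpos, hd⟩ := ih
    obtain ⟨B, hB, hBb, hBd, hB1⟩ := exists_disjoint_isBounded_le_measure hbdd hinf
      (D := ⋃ j, A j) (Bornology.isBounded_iUnion.2 hb) 1
    have hBd' : ∀ j, Disjoint (A j) B := fun j => hBd.mono_left (subset_iUnion A j)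
    have hB0 : μ B ≠ 0 := fun h0 => by simp [h0] at hB1
    refine ⟨Fin.cons B A, Fin.cases hB hA, Fin.cases hBb hb, Fin.cases hB0 hpos, ?_⟩
    · intro i j
      refine Fin.cases ?_ (fun i => ?_) i <;> refine Fin.cases ?_ (fun j => ?_) j
      · exact fun h => absurd rfl h
      · exact fun _ => (hBd' j).symm
      · exact fun _ => hBd' i
      · exact fun hij => hd i j fun h => hij (h ▸ rfl)

variable [MeasurableSpace Ω]

theorem measurable_count {N : Ω → Config X} (hN : Measurable N) {A : Set X}
    (hA : MeasurableSet A) : Measurable (count N A) :=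
  ((measurable_eval hA).comp hN).ennreal_toReal

/-- A finite family of Poisson `T`-point processes over the same system, of intensities `α_i μ`,
which are pairwise dissociated. -/
structure DissociatedPoisson (T : X ≃ᵐ X) (μ : Measure X) (P : Measure Ω) (S : Ω ≃ᵐ Ω) {k : ℕ}
    (α : Fin k → ℝ≥0) (N : Fin k → Ω → Config X) : Prop where
  pos : ∀ i, 0 < α i
  process : ∀ i, IsTPointProcess T μ P S (N i)
  poisson : ∀ i, IsPoissonProcess (α i • μ) P (N i)
  dissociated : ∀ i j, i ≠ j → Dissociated P S (N i) (N j)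

/-- Sums of variables with exponential moments of all orders have exponential moments of all
orders. -/
theorem integrable_exp_mul_sum {P : Measure Ω} [IsFiniteMeasure P] {ι : Type*} {Y : ι → Ω → ℝ}
    (U : Finset ι) (hY : ∀ p ∈ U, Measurable (Y p))
    (h : ∀ p ∈ U, ∀ t : ℝ, Integrable (fun ω => Real.exp (t * Y p ω)) P) (t : ℝ) :
    Integrable (fun ω => Real.exp (t * ∑ p ∈ U, Y p ω)) P := by
  classical
  induction U using Finset.induction_on generalizing t with
  | empty => simp
  | insert a U ha ih =>
    have hYU : ∀ p ∈ U, Measurable (Y p) := fun p hp => hY p (Finset.mem_insert_of_mem hp)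
    have h1 := h a (Finset.mem_insert_self a U) (2 * t)
    have h2 := ih hYU (fun p hp => h p (Finset.mem_insert_of_mem hp)) (2 * t)
    have hm : Measurable fun ω => ∑ p ∈ insert a U, Y p ω := Finset.measurable_fun_sum _ hY
    refine (h1.add h2).mono' (by fun_prop) (.of_forall fun ω => ?_)
    rw [Finset.sum_insert ha, mul_add, Real.exp_add, Real.norm_of_nonneg (by positivity)]
    simp only [Pi.add_apply]
    have e1 : Real.exp (2 * t * Y a ω) = Real.exp (t * Y a ω) ^ 2 := by
      rw [← Real.exp_nat_mul]; congr 1; push_cast; ring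
    have e2 : Real.exp (2 * t * ∑ p ∈ U, Y p ω) = Real.exp (t * ∑ p ∈ U, Y p ω) ^ 2 := by
      rw [← Real.exp_nat_mul]; congr 1; push_cast; ring
    rw [e1, e2]
    nlinarith [sq_nonneg (Real.exp (t * Y a ω) - Real.exp (t * ∑ p ∈ U, Y p ω)),
      sq_nonneg (Real.exp (t * Y a ω)), sq_nonneg (Real.exp (t * ∑ p ∈ U, Y p ω))]

variable {T : X ≃ᵐ X} {μ : Measure X} {P : Measure Ω} {S : Ω ≃ᵐ Ω}
  {k : ℕ} {α : Fin k → ℝ≥0} {N : Fin k → Ω → Config X}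

theorem DissociatedPoisson.null (h : DissociatedPoisson T μ P S α N) (i : Fin k) (A : Set X)
    (hA : MeasurableSet A) (h0 : (α i • μ) A = 0) : ∀ᵐ ω ∂P, (N i ω).1 A = 0 := by
  refine (h.process i).null A hA ?_
  rw [Measure.smul_apply, ENNReal.smul_def, smul_eq_mul, mul_eq_zero] at h0
  exact h0.resolve_left (by simpa using (h.pos i).ne')

variable [IsProbabilityMeasure P]

theorem DissociatedPoisson.integrable_exp_sum (h : DissociatedPoisson T μ P S α N)
    (hbdd : BoundedlyFinite μ) {ι : Type*} (U : Finset ι) (l : ι → Fin k) {A : ι → Set X}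
    (hA : ∀ p ∈ U, MeasurableSet (A p)) (hb : ∀ p ∈ U, Bornology.IsBounded (A p)) (t : ℝ) :
    Integrable (fun ω => Real.exp (t * ∑ p ∈ U, count (N (l p)) (A p) ω)) P :=
  integrable_exp_mul_sum U (fun p hp => measurable_count (h.process (l p)).measurable (hA p hp))
    (fun p hp t => (h.poisson (l p)).integrable_exp (h.null (l p)) (hA p hp)
      (intensity_lt_top hbdd _ (hb p hp)) t) t

theorem DissociatedPoisson.integrable_prod_pow (h : DissociatedPoisson T μ P S α N)
    (hbdd : BoundedlyFinite μ) {ι : Type*} (U : Finset ι) (l : ι → Fin k) {A : ι → Set X}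
    (hA : ∀ p ∈ U, MeasurableSet (A p)) (hb : ∀ p ∈ U, Bornology.IsBounded (A p)) (r : ℕ) :
    Integrable (fun ω => (∏ p ∈ U, count (N (l p)) (A p) ω) ^ r) P := by
  have hm : Measurable fun ω => ∏ p ∈ U, count (N (l p)) (A p) ω :=
    Finset.measurable_fun_prod _ fun p hp =>
      measurable_count (h.process (l p)).measurable (hA p hp)
  refine (h.integrable_exp_sum hbdd U l hA hb r).mono' (hm.pow_const r).aestronglyMeasurable
    (.of_forall fun ω => ?_)
  have h0 : 0 ≤ ∏ p ∈ U, count (N (l p)) (A p) ω :=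
    Finset.prod_nonneg fun p _ => count_nonneg _ _ _
  rw [Real.norm_of_nonneg (by positivity), Real.exp_nat_mul]
  exact pow_le_pow_left₀ h0 (prod_count_le_exp U l A ω) r

theorem DissociatedPoisson.lintegral_prod (h : DissociatedPoisson T μ P S α N)
    (hbdd : BoundedlyFinite μ) {n : ℕ} (l : Fin n → Fin k) {A : Fin n → Set X}
    (hA : ∀ p, MeasurableSet (A p)) (hb : ∀ p, Bornology.IsBounded (A p)) :
    ∫⁻ ω, ∏ j, (N (l j) ω).1 (A j) ∂P =
      ENNReal.ofReal (∫ ω, ∏ j, count (N (l j)) (A j) ω ∂P) := by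
  have hint := h.integrable_prod_pow hbdd Finset.univ l (A := A) (fun p _ => hA p)
    (fun p _ => hb p) 1
  simp only [pow_one] at hint
  rw [ofReal_integral_eq_lintegral_ofReal hint
    (.of_forall fun ω => Finset.prod_nonneg fun p _ => count_nonneg _ _ _)]
  refine lintegral_congr fun ω => ?_
  rw [ENNReal.ofReal_prod_of_nonneg fun p _ => count_nonneg _ _ _]
  exact Finset.prod_congr rfl fun j _ => (ofReal_count _ (hb j) ω).symm

/-- The weak law of large numbers in the form needed: against a square integrable variable, the
number of points in a set of large measure deviates from its mean by the order of the square root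
of the measure only. -/
theorem DissociatedPoisson.abs_integral_mul_count_sub_le (h : DissociatedPoisson T μ P S α N)
    (hbdd : BoundedlyFinite μ) {Y : Ω → ℝ} (hY : Integrable Y P)
    (hY2 : Integrable (fun ω => Y ω ^ 2) P) (i : Fin k) {B : Set X} (hB : MeasurableSet B)
    (hb : Bornology.IsBounded B) {s : ℝ} (hs : 0 < s) (hsB : μ B = ENNReal.ofReal (s ^ 2)) :
    Integrable (fun ω => Y ω * count (N i) B ω) P ∧
    |∫ ω, Y ω * count (N i) B ω ∂P - α i * s ^ 2 * ∫ ω, Y ω ∂P| ≤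
      s * (∫ ω, Y ω ^ 2 ∂P + α i) := by
  have hfin : (α i • μ) B < ∞ := intensity_lt_top hbdd _ hb
  have hν : (α i • μ) B = ENNReal.ofReal (α i * s ^ 2) := by
    rw [Measure.smul_apply, ENNReal.smul_def, smul_eq_mul, hsB, ENNReal.ofReal_mul (by positivity),
      ENNReal.ofReal_coe_nnreal]
  set a : ℝ := α i * s ^ 2 with ha
  have ha0 : 0 ≤ a := by positivity
  set n := count (N i) B with hn
  have hnm : Measurable n := measurable_count (h.process i).measurable hB
  have hn0 : ∀ ω, 0 ≤ n ω := count_nonneg _ _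
  have hexp := fun t => h.integrable_exp_sum hbdd {()} (fun _ => i) (A := fun _ => B)
    (fun _ _ => hB) (fun _ _ => hb) t
  simp only [Finset.sum_singleton] at hexp
  have hi1 : Integrable n P := by
    simpa using integrable_pow_of_integrable_exp_mul one_ne_zero (hexp 1) (hexp (-1)) 1
  have hi2 : Integrable (fun ω => n ω ^ 2) P :=
    integrable_pow_of_integrable_exp_mul one_ne_zero (hexp 1) (hexp (-1)) 2
  have e1 : ∫ ω, n ω ∂P = a := by
    rw [integral_eq_lintegral_of_nonneg_ae (.of_forall hn0) hnm.aestronglyMeasurable]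
    simp only [hn, ofReal_count _ hb]
    rw [(h.poisson i).lintegral_eq (h.null i) hB hfin, hν, ENNReal.toReal_ofReal ha0]
  have e2 : ∫ ω, n ω ^ 2 ∂P = a * (a + 1) := by
    rw [integral_eq_lintegral_of_nonneg_ae (.of_forall fun ω => sq_nonneg _)
      (hnm.pow_const 2).aestronglyMeasurable]
    simp only [hn, ENNReal.ofReal_pow (count_nonneg _ _ _), ofReal_count _ hb]
    rw [(h.poisson i).lintegral_sq_eq (h.null i) hB hfin, hν, ← ENNReal.ofReal_one,
      ← ENNReal.ofReal_add ha0 zero_le_one, ← ENNReal.ofReal_mul ha0,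
      ENNReal.toReal_ofReal (by positivity)]
  have hYn : Integrable (fun ω => Y ω * n ω) P := by
    refine (hY2.add hi2).mono' (hY.1.mul hnm.aestronglyMeasurable) (.of_forall fun ω => ?_)
    simp only [Pi.add_apply, Real.norm_eq_abs]
    rw [abs_le]
    constructor <;> nlinarith [sq_nonneg (Y ω - n ω), sq_nonneg (Y ω + n ω)]
  refine ⟨hYn, ?_⟩
  have hsq : ∀ ω, (n ω - a) ^ 2 = n ω ^ 2 - 2 * a * n ω + a ^ 2 := fun ω => by ring
  have hi3 : Integrable (fun ω => 2 * a * n ω) P := hi1.const_mul _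
  have hi4 : Integrable (fun ω => n ω ^ 2 - 2 * a * n ω) P := hi2.sub hi3
  have hvar : ∫ ω, (n ω - a) ^ 2 ∂P = a := by
    simp_rw [hsq]
    rw [integral_add hi4 (integrable_const _), integral_sub hi2 hi3, integral_const_mul, e1, e2]
    simp
    ring
  have hvi : Integrable (fun ω => (n ω - a) ^ 2) P := by
    simp_rw [hsq]
    exact hi4.add (integrable_const _)
  have hdiff : ∫ ω, Y ω * n ω ∂P - a * ∫ ω, Y ω ∂P = ∫ ω, Y ω * (n ω - a) ∂P := by
    rw [← integral_const_mul, ← integral_sub hYn (hY.const_mul a)]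
    congr 1 with ω
    ring
  rw [hdiff]
  have hbound : ∫ ω, (s * Y ω ^ 2 + s⁻¹ * (n ω - a) ^ 2) ∂P = s * (∫ ω, Y ω ^ 2 ∂P + α i) := by
    rw [integral_add (hY2.const_mul s) (hvi.const_mul _), integral_const_mul, integral_const_mul,
      hvar, ha]
    field_simp
  rw [← hbound]
  -- weighted inequality of arithmetic and geometric means, the weight balancing the two terms
  refine (abs_integral_le_integral_abs).trans (integral_mono_of_nonneg
    (.of_forall fun _ => abs_nonneg _) ((hY2.const_mul s).add (hvi.const_mul _))
    (.of_forall fun ω => ?_))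
  have hs2 : s * s⁻¹ = 1 := mul_inv_cancel₀ hs.ne'
  have key : s * Y ω ^ 2 + s⁻¹ * (n ω - a) ^ 2 - 2 * (Y ω * (n ω - a)) =
      s⁻¹ * (s * Y ω - (n ω - a)) ^ 2 := by field_simp; ring
  have key' : s * Y ω ^ 2 + s⁻¹ * (n ω - a) ^ 2 + 2 * (Y ω * (n ω - a)) =
      s⁻¹ * (s * Y ω + (n ω - a)) ^ 2 := by field_simp; ring
  have p1 : 0 ≤ s⁻¹ * (s * Y ω - (n ω - a)) ^ 2 := by positivity
  have p2 : 0 ≤ s⁻¹ * (s * Y ω + (n ω - a)) ^ 2 := by positivity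
  have p3 : 0 ≤ s * Y ω ^ 2 + s⁻¹ * (n ω - a) ^ 2 := by positivity
  simp only [abs_le]
  constructor <;> linarith

variable [SecondCountableTopology X] [BorelSpace X] [Nonempty X]

/-- Two points of the processes on a common orbit are the same point of the same process: different
processes are dissociated, and one process has no two distinct points on one orbit, being
Poisson. -/
theorem DissociatedPoisson.ae_orbit (h : DissociatedPoisson T μ P S α N)
    (hbdd : BoundedlyFinite μ) [NullSingletonClass μ] :
    ∀ᵐ ω ∂P, ∀ i j : Fin k, ∀ m : ℕ, ∀ x ∈ (N i ω).points, ∀ y ∈ (N j ω).points,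
      x = T^[m] y → i = j ∧ x = y := by
  refine ae_all_iff.2 fun i => ae_all_iff.2 fun j => ae_all_iff.2 fun m => ?_
  by_cases hij : i = j
  · subst hij
    have hbdd' : BoundedlyFinite (α i • μ) := fun B hB => intensity_lt_top hbdd _ hB
    have : NullSingletonClass (α i • μ) := ⟨fun x => by simp⟩
    filter_upwards [(h.poisson i).ae_eq_of_mem_graph hbdd' (h.null i) (T.measurable.iterate m)]
      with ω hω x hx y hy hxy
    exact ⟨rfl, hω x hx y hy hxy⟩
  · filter_upwards [(h.process j).ae_iterate_mem_points m, h.dissociated i j hij m]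
      with ω h1 h2 x hx y hy hxy
    refine absurd ⟨hx, ?_⟩ (h2 x)
    rw [zpowMap_natCast, hxy]
    exact h1 y hy

/-- Joint moments over sets which are disjoint for each of the processes are proportional to the
product of the measures of the sets: almost surely the tuples counted have entries on distinct
orbits, and on such tuples the moment measure is a multiple of the product measure by (P2). -/
theorem DissociatedPoisson.exists_integral_prod_eq (h : DissociatedPoisson T μ P S α N)
    (hbdd : BoundedlyFinite μ) [NullSingletonClass μ] (hP2 : PropertyP2 T μ)
    (hS : MeasurePreserving S P P) {n : ℕ} (hn : 1 ≤ n) (l : Fin n → Fin k) :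
    ∃ C : ℝ≥0∞, ∀ A : Fin n → Set X, (∀ j, MeasurableSet (A j)) →
      (∀ j, Bornology.IsBounded (A j)) →
      (∀ i j, i ≠ j → l i = l j → Disjoint (A i) (A j)) →
      ENNReal.ofReal (∫ ω, ∏ j, count (N (l j)) (A j) ω ∂P) = C * ∏ j, μ (A j) := by
  have hsf : SigmaFinite μ := hbdd.sigmaFinite
  have hM : ∀ j, IsTPointProcess T μ P S (N (l j)) := fun j => h.process (l j)
  have hMm : ∀ j, Measurable (N (l j)) := fun j => (hM j).measurable
  have hσ : BoundedlyFinite (momentMeasure P fun j => N (l j)) := by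
    refine boundedlyFinite_momentMeasure hMm fun A hA hb => ?_
    rw [h.lintegral_prod hbdd l hA hb]
    exact ENNReal.ofReal_lt_top
  obtain ⟨C, hC⟩ := hP2.exists_eq_mul_prod hbdd hn hσ (measurePreserving_momentMeasure hM hS hσ)
    (map_momentMeasure_absolutelyContinuous hM)
  refine ⟨C, fun A hA hb hd => ?_⟩
  rw [← h.lintegral_prod hbdd l hA hb, ← momentMeasure_box hMm hA, ← hC A hA hb]
  refine momentMeasure_inter_of_ae hMm (.univ_pi hA) (measurableSet_distinctOrbits T n) ?_
  filter_upwards [h.ae_orbit hbdd] with ω hω x hxA hx i j hji m hxy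
  obtain ⟨hl, heq⟩ := hω (l i) (l j) m _ (hx i) _ (hx j) hxy
  exact Set.disjoint_left.1 (hd i j hji.symm hl) (hxA i (mem_univ i)) (heq ▸ hxA j (mem_univ j))

end JointMoments

/-! ### Factorization of the joint moments -/

section Factorization

open Filter Topology

variable {X Ω : Type*} [MetricSpace X] [SecondCountableTopology X] [MeasurableSpace X]
  [BorelSpace X] [Nonempty X] [MeasurableSpace Ω] {T : X ≃ᵐ X} {μ : Measure X}
  [NullSingletonClass μ] {P : Measure Ω} [IsProbabilityMeasure P] {S : Ω ≃ᵐ Ω}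
  {k : ℕ} {α : Fin k → ℝ≥0} {N : Fin k → Ω → Config X}

/-- The constant of proportionality in the joint moments is computed by letting the sets grow one
at a time: by the law of large numbers, each of them contributes its mean. -/
theorem DissociatedPoisson.integral_prod_fin_eq (h : DissociatedPoisson T μ P S α N)
    (hbdd : BoundedlyFinite μ) (hinf : μ univ = ⊤) (hP2 : PropertyP2 T μ)
    (hS : MeasurePreserving S P P) {n : ℕ} (l : Fin n → Fin k) (A : Fin n → Set X)
    (hA : ∀ j, MeasurableSet (A j)) (hb : ∀ j, Bornology.IsBounded (A j))
    (hd : ∀ i j, i ≠ j → l i = l j → Disjoint (A i) (A j)) :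
    ∫ ω, ∏ j, count (N (l j)) (A j) ω ∂P = ∏ j, α (l j) * (μ (A j)).toReal := by
  induction n with
  | zero => simp
  | succ n ih =>
    obtain ⟨C, hC⟩ := h.exists_integral_prod_eq hbdd hP2 hS n.succ_pos l
    obtain ⟨D, hD, hDb, hDpos, hDd⟩ := exists_pairwise_disjoint_isBounded hbdd hinf n
    set Y : Ω → ℝ := fun ω => ∏ j : Fin n, count (N (l j.succ)) (D j) ω with hY
    set p : ℝ := ∏ j, (μ (D j)).toReal with hp
    have hppos : 0 < p := Finset.prod_pos fun j _ =>
      ENNReal.toReal_pos (hDpos j) (hbdd _ (hDb j)).ne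
    set b : ℝ := ∏ j : Fin n, (α (l j.succ) : ℝ) with hbdef
    have hEY : ∫ ω, Y ω ∂P = b * p := by
      rw [ih (fun j => l j.succ) D hD hDb fun i j hij _ => hDd i j hij, Finset.prod_mul_distrib]
    have hYi : Integrable Y P := by
      simpa using h.integrable_prod_pow hbdd Finset.univ (fun j => l (Fin.succ j)) (A := D)
        (fun j _ => hD j) (fun j _ => hDb j) 1
    have hY2 : Integrable (fun ω => Y ω ^ 2) P :=
      h.integrable_prod_pow hbdd Finset.univ (fun j => l (Fin.succ j)) (A := D)
        (fun j _ => hD j) (fun j _ => hDb j) 2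
    have hB : ∀ K : ℝ≥0, 0 < K → ∃ s : ℝ, (K : ℝ) ≤ s ^ 2 ∧ 0 < s ∧ ∃ I : ℝ,
        |I - α (l 0) * s ^ 2 * (b * p)| ≤ s * (∫ ω, Y ω ^ 2 ∂P + α (l 0)) ∧
        ENNReal.ofReal I = C * ENNReal.ofReal (s ^ 2 * p) ∧ 0 ≤ I := by
      intro K hK
      obtain ⟨B, hBm, hBb, hBd, hBK⟩ := exists_disjoint_isBounded_le_measure hbdd hinf
        (D := ⋃ j, D j) (Bornology.isBounded_iUnion.2 hDb) K
      have hBd' : ∀ j, Disjoint (D j) B := fun j => hBd.mono_left (subset_iUnion D j)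
      have hBfin : μ B ≠ ∞ := (hbdd _ hBb).ne
      have hsq : Real.sqrt (μ B).toReal ^ 2 = (μ B).toReal := Real.sq_sqrt ENNReal.toReal_nonneg
      have hKB : (K : ℝ) ≤ (μ B).toReal := by
        simpa using ENNReal.toReal_mono hBfin hBK
      have hspos : 0 < Real.sqrt (μ B).toReal :=
        Real.sqrt_pos.2 ((NNReal.coe_pos.2 hK).trans_le hKB)
      have hμB : μ B = ENNReal.ofReal (Real.sqrt (μ B).toReal ^ 2) := by
        rw [hsq, ENNReal.ofReal_toReal hBfin]
      refine ⟨Real.sqrt (μ B).toReal, by rwa [hsq], hspos, ∫ ω, Y ω * count (N (l 0)) B ω ∂P,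
        ?_, ?_, ?_⟩
      · rw [← hEY]
        exact (h.abs_integral_mul_count_sub_le hbdd hYi hY2 (l 0) hBm hBb hspos hμB).2
      · have := hC (Fin.cons B D) (Fin.cases hBm hD) (Fin.cases hBb hDb) (by
          intro i j
          refine Fin.cases ?_ (fun i => ?_) i <;> refine Fin.cases ?_ (fun j => ?_) j
          · exact fun h => absurd rfl h
          · exact fun _ _ => (hBd' j).symm
          · exact fun _ _ => hBd' i
          · exact fun hij _ => hDd i j fun h => hij (h ▸ rfl))
        simp only [Fin.prod_univ_succ, Fin.cons_zero, Fin.cons_succ] at this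
        simp only [mul_comm (Y _)]
        rw [this, ENNReal.ofReal_mul (sq_nonneg _), ← hμB, hp,
          ENNReal.ofReal_prod_of_nonneg fun _ _ => ENNReal.toReal_nonneg]
        simp only [fun j => ENNReal.ofReal_toReal (hbdd _ (hDb j)).ne]
      · exact integral_nonneg fun ω => mul_nonneg
          (Finset.prod_nonneg fun j _ => count_nonneg _ _ _) (count_nonneg _ _ _)
    have hCtop : C ≠ ∞ := by
      rintro rfl
      obtain ⟨s, -, hs, I, -, hI, -⟩ := hB 1 one_pos
      rw [ENNReal.top_mul (ENNReal.ofReal_pos.2 (by positivity)).ne'] at hI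
      exact ENNReal.ofReal_ne_top hI
    have hCeq : C.toReal = α (l 0) * b := by
      by_contra hne
      set δ : ℝ := |C.toReal - α (l 0) * b| * p with hδ
      have hδpos : 0 < δ := mul_pos (abs_pos.2 (sub_ne_zero.2 hne)) hppos
      set Q : ℝ := ∫ ω, Y ω ^ 2 ∂P + α (l 0) with hQ
      have hQ0 : 0 ≤ Q := add_nonneg (integral_nonneg fun ω => sq_nonneg _) (α (l 0)).2
      -- the deviation grows like `s ^ 2`, but is at most of the order of `s`
      obtain ⟨s, hKs, hs, I, hI1, hI2, hI0⟩ := hB (Real.toNNReal ((Q / δ + 1) ^ 2))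
        (Real.toNNReal_pos.2 (by positivity))
      have hI : I = C.toReal * (s ^ 2 * p) := by
        rw [← ENNReal.toReal_ofReal hI0, hI2, ENNReal.toReal_mul,
          ENNReal.toReal_ofReal (by positivity)]
      have hIe : I - α (l 0) * s ^ 2 * (b * p) = s ^ 2 * ((C.toReal - α (l 0) * b) * p) := by
        rw [hI]; ring
      rw [hIe, abs_mul, abs_mul, abs_of_pos hppos, abs_of_pos (pow_pos hs 2), sq, mul_assoc] at hI1
      have h1 : s * δ ≤ Q := le_of_mul_le_mul_left hI1 hs
      rw [Real.coe_toNNReal _ (by positivity)] at hKs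
      have h2 : Q / δ + 1 ≤ s := le_of_sq_le_sq hKs hs.le
      have h3 : s ≤ Q / δ := (le_div_iff₀ hδpos).2 h1
      linarith
    have hfinal := congrArg ENNReal.toReal (hC A hA hb hd)
    rw [ENNReal.toReal_ofReal (integral_nonneg fun ω =>
      Finset.prod_nonneg fun j _ => count_nonneg _ _ _), ENNReal.toReal_mul,
      ENNReal.toReal_prod, hCeq] at hfinal
    rw [hfinal, Finset.prod_mul_distrib, Fin.prod_univ_succ (fun j => (α (l j) : ℝ))]

theorem DissociatedPoisson.integral_prod_eq (h : DissociatedPoisson T μ P S α N)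
    (hbdd : BoundedlyFinite μ) (hinf : μ univ = ⊤) (hP2 : PropertyP2 T μ)
    (hS : MeasurePreserving S P P) {ι : Type*} (U : Finset ι) (l : ι → Fin k) (A : ι → Set X)
    (hA : ∀ p ∈ U, MeasurableSet (A p)) (hb : ∀ p ∈ U, Bornology.IsBounded (A p))
    (hd : ∀ p ∈ U, ∀ q ∈ U, p ≠ q → l p = l q → Disjoint (A p) (A q)) :
    ∫ ω, ∏ p ∈ U, count (N (l p)) (A p) ω ∂P = ∏ p ∈ U, α (l p) * (μ (A p)).toReal := by
  have hreindex : ∀ f : ι → ℝ, ∏ p ∈ U, f p = ∏ j, f (U.equivFin.symm j) := fun f => by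
    rw [← Finset.prod_coe_sort U f]
    exact (Equiv.prod_comp U.equivFin.symm fun p : U => f p).symm
  simp only [hreindex]
  exact h.integral_prod_fin_eq hbdd hinf hP2 hS (fun j => l (U.equivFin.symm j))
    (fun j => A (U.equivFin.symm j)) (fun j => hA _ (U.equivFin.symm j).2)
    (fun j => hb _ (U.equivFin.symm j).2) fun i j hij hl => hd _ (U.equivFin.symm i).2 _
      (U.equivFin.symm j).2 (fun h => hij (U.equivFin.symm.injective (Subtype.ext h))) hl

/-! ### Independence of void events -/

theorem prod_one_sub_eq_sum {ι : Type*} (U : Finset ι) (f : ι → ℝ) :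
    ∏ p ∈ U, (1 - f p) = ∑ V ∈ U.powerset, (-1) ^ V.card * ∏ p ∈ V, f p := by
  simp only [sub_eq_add_neg, Finset.prod_one_add, Finset.prod_neg]

/-- Once the cells are fine enough to contain at most one point each, the product of the factors
`1 - N (A ∩ c)` is the indicator of the void event `N A = 0`. -/
theorem eventually_prod_one_sub_count {X Ω : Type*} [MetricSpace X]
    [SecondCountableTopology X] [MeasurableSpace X] [BorelSpace X] (N : Ω → Config X) {A : Set X}
    (hA : MeasurableSet A) (hb : Bornology.IsBounded A) (ω : Ω) :
    ∀ᶠ n in atTop, ∏ c ∈ cells X n, (1 - count N (A ∩ c) ω) =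
      {ω | (N ω).1 A = 0}.indicator 1 ω := by
  filter_upwards [(N ω).eventually_cells_le_one hA hb] with n hn
  by_cases h0 : (N ω).1 A = 0
  · rw [indicator_of_mem (by exact h0)]
    refine Finset.prod_eq_one fun c _ => ?_
    simp [count, measure_mono_null inter_subset_left h0]
  · rw [indicator_of_notMem (by exact h0)]
    rw [measure_eq_sum_cells _ n hA] at h0
    obtain ⟨c, hc, hne⟩ := Finset.exists_ne_zero_of_sum_ne_zero h0
    refine Finset.prod_eq_zero hc ?_
    have h1 : (N ω).1 (A ∩ c) = 1 := le_antisymm (hn c hc)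
      (((N ω).eq_zero_or_one_le (hA.inter (measurableSet_of_mem_cells hc))).resolve_left hne)
    simp [count, h1]

theorem DissociatedPoisson.integral_prod_one_sub_eq (h : DissociatedPoisson T μ P S α N)
    (hbdd : BoundedlyFinite μ) (hinf : μ univ = ⊤) (hP2 : PropertyP2 T μ)
    (hS : MeasurePreserving S P P) {ι : Type*} (U : Finset ι) (l : ι → Fin k) (A : ι → Set X)
    (hA : ∀ p ∈ U, MeasurableSet (A p)) (hb : ∀ p ∈ U, Bornology.IsBounded (A p))
    (hd : ∀ p ∈ U, ∀ q ∈ U, p ≠ q → l p = l q → Disjoint (A p) (A q)) :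
    ∫ ω, ∏ p ∈ U, (1 - count (N (l p)) (A p) ω) ∂P =
      ∏ p ∈ U, (1 - α (l p) * (μ (A p)).toReal) := by
  simp only [prod_one_sub_eq_sum]
  rw [integral_finsetSum]
  · refine Finset.sum_congr rfl fun V hV => ?_
    have hVU := Finset.mem_powerset.1 hV
    rw [integral_const_mul, h.integral_prod_eq hbdd hinf hP2 hS V l A (fun p hp => hA p (hVU hp))
      (fun p hp => hb p (hVU hp)) fun p hp q hq => hd p (hVU hp) q (hVU hq)]
  · intro V hV
    have hVU := Finset.mem_powerset.1 hV
    have := h.integrable_prod_pow hbdd V l (fun p hp => hA p (hVU hp))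
      (fun p hp => hb p (hVU hp)) 1
    simp only [pow_one] at this
    exact this.const_mul _

/-- The probability that several of the processes avoid given sets is the limit, along finer and
finer partitions, of a product over the processes. -/
theorem DissociatedPoisson.tendsto_prod_void (h : DissociatedPoisson T μ P S α N)
    (hbdd : BoundedlyFinite μ) (hinf : μ univ = ⊤) (hP2 : PropertyP2 T μ)
    (hS : MeasurePreserving S P P) (L : Finset (Fin k)) (A : Fin k → Set X)
    (hA : ∀ i ∈ L, MeasurableSet (A i)) (hb : ∀ i ∈ L, Bornology.IsBounded (A i)) :
    Tendsto (fun n => ∏ i ∈ L, ∏ c ∈ cells X n, (1 - α i * (μ (A i ∩ c)).toReal)) atTop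
      (𝓝 (P.real (⋂ i ∈ L, {ω | (N i ω).1 (A i) = 0}))) := by
  have hmem : ∀ {n} {p : Fin k × Set X}, p ∈ L ×ˢ cells X n → p.1 ∈ L ∧ p.2 ∈ cells X n :=
    fun hp => Finset.mem_product.1 hp
  have hEm : MeasurableSet (⋂ i ∈ L, {ω | (N i ω).1 (A i) = 0}) :=
    L.measurableSet_biInter fun i hi =>
      ((measurable_eval (hA i hi)).comp (h.process i).measurable) (measurableSet_singleton 0)
  have hint : ∀ n, ∫ ω, ∏ i ∈ L, ∏ c ∈ cells X n, (1 - count (N i) (A i ∩ c) ω) ∂P =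
      ∏ i ∈ L, ∏ c ∈ cells X n, (1 - α i * (μ (A i ∩ c)).toReal) := by
    intro n
    simp_rw [← Finset.prod_product']
    refine h.integral_prod_one_sub_eq hbdd hinf hP2 hS (L ×ˢ cells X n) Prod.fst
      (fun p => A p.1 ∩ p.2) (fun p hp => (hA _ (hmem hp).1).inter
        (measurableSet_of_mem_cells (hmem hp).2))
      (fun p hp => (hb _ (hmem hp).1).subset inter_subset_left) ?_
    intro p hp q hq hpq hl
    refine (disjoint_cells (hmem hp).2 (hmem hq).2 fun h2 => hpq (Prod.ext hl h2)).mono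
      inter_subset_right inter_subset_right
  rw [← integral_indicator_one hEm]
  simp_rw [← hint]
  refine tendsto_integral_of_dominated_convergence
    (fun ω => Real.exp (1 * ∑ i ∈ L, count (N i) (A i) ω)) (fun n => ?_)
    (h.integrable_exp_sum hbdd L id hA hb 1) (fun n => .of_forall fun ω => ?_)
    (.of_forall fun ω => ?_)
  · refine (Finset.measurable_fun_prod _ fun i hi => Finset.measurable_fun_prod _ fun c hc =>
      ?_).aestronglyMeasurable
    exact measurable_const.sub (measurable_count (h.process i).measurable
      ((hA i hi).inter (measurableSet_of_mem_cells hc)))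
  · rw [one_mul, Real.exp_sum, norm_prod]
    refine Finset.prod_le_prod (fun _ _ => norm_nonneg _) fun i hi => ?_
    have hsum : count (N i) (A i) ω = ∑ c ∈ cells X n, count (N i) (A i ∩ c) ω := by
      rw [count, measure_eq_sum_cells _ n (hA i hi), ENNReal.toReal_sum]
      · rfl
      · exact fun c _ => ((N i ω).2.1 _ ((hb i hi).subset inter_subset_left)).ne
    rw [hsum, Real.exp_sum, norm_prod]
    refine Finset.prod_le_prod (fun _ _ => norm_nonneg _) fun c _ => ?_
    have h0 := count_nonneg (N i) (A i ∩ c) ω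
    have h1 := Real.add_one_le_exp (count (N i) (A i ∩ c) ω)
    rw [Real.norm_eq_abs, abs_le]
    constructor <;> linarith
  · refine tendsto_const_nhds.congr' ?_
    have hev : ∀ᶠ n in atTop, ∀ i ∈ L, ∏ c ∈ cells X n, (1 - count (N i) (A i ∩ c) ω) =
        {ω | (N i ω).1 (A i) = 0}.indicator 1 ω :=
      (eventually_all_finset L).2 fun i hi =>
        eventually_prod_one_sub_count (N i) (hA i hi) (hb i hi) ω
    filter_upwards [hev] with n hn
    rw [Finset.prod_congr rfl hn]
    by_cases hω : ω ∈ ⋂ i ∈ L, {ω | (N i ω).1 (A i) = 0}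
    · rw [indicator_of_mem hω]
      symm
      exact Finset.prod_eq_one fun i hi => indicator_of_mem (mem_iInter₂.1 hω i hi) 1
    · rw [indicator_of_notMem hω]
      simp only [mem_iInter, not_forall] at hω
      obtain ⟨i, hi, hni⟩ := hω
      symm
      exact Finset.prod_eq_zero hi (indicator_of_notMem hni 1)

theorem DissociatedPoisson.iIndepFun (h : DissociatedPoisson T μ P S α N)
    (hbdd : BoundedlyFinite μ) (hinf : μ univ = ⊤) (hP2 : PropertyP2 T μ)
    (hS : MeasurePreserving S P P) : iIndepFun N P := by
  have hcomap : ∀ i, (inferInstance : MeasurableSpace (Config X)).comap (N i) =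
      MeasurableSpace.generateFrom ((N i ⁻¹' ·) '' voidEvents X) := fun i => by
    rw [generateFrom_voidEvents, MeasurableSpace.comap_generateFrom]
  refine iIndepSets.iIndep (fun i => (h.process i).measurable.comap_le)
    (fun i => (N i ⁻¹' ·) '' voidEvents X) (fun i => ?_) hcomap ?_
  · exact isPiSystem_voidEvents.comap (N i)
  rw [iIndepSets_iff]
  intro L f hf
  choose! D hD hDf using hf
  have hD' : ∀ i ∈ L, ∃ A : Set X, MeasurableSet A ∧ Bornology.IsBounded A ∧
      f i = {ω | (N i ω).1 A = 0} := by
    intro i hi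
    obtain ⟨A, hA, hb, hDA⟩ := hD i hi
    refine ⟨A, hA, hb, ?_⟩
    rw [← hDf i hi, hDA]
    rfl
  choose! A hA hb hf using hD'
  have hlim := h.tendsto_prod_void hbdd hinf hP2 hS L A hA hb
  have hlim' : Tendsto (fun n => ∏ i ∈ L, ∏ c ∈ cells X n, (1 - α i * (μ (A i ∩ c)).toReal)) atTop
      (𝓝 (∏ i ∈ L, P.real {ω | (N i ω).1 (A i) = 0})) := by
    refine tendsto_finsetProd L fun i hi => ?_
    have := h.tendsto_prod_void hbdd hinf hP2 hS {i} A (by simpa using hA i hi)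
      (by simpa using hb i hi)
    simpa using this
  have heq := tendsto_nhds_unique hlim hlim'
  have hfL : ⋂ i ∈ L, f i = ⋂ i ∈ L, {ω | (N i ω).1 (A i) = 0} := iInter₂_congr hf
  rw [hfL, Finset.prod_congr rfl fun i hi => congrArg P (hf i hi),
    ← ENNReal.toReal_eq_toReal_iff' (measure_ne_top _ _)
      (ENNReal.prod_ne_top fun i _ => measure_ne_top _ _), ENNReal.toReal_prod]
  exact heq

end Factorization

end TPoint

end

theorem mainTheorem10 {X Ω : Type*}
    [MetricSpace X] [CompleteSpace X] [SecondCountableTopology X]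
    [MeasurableSpace X] [BorelSpace X]
    (μ : MeasureTheory.Measure X) (T : X ≃ᵐ X)
    (hμ_bdd : TPoint.BoundedlyFinite μ) (hμ_inf : μ Set.univ = ⊤)
    (hT_erg : Ergodic T μ) (hT_cons : MeasureTheory.Conservative T μ)
    (hP1 : TPoint.PropertyP1 T μ) (hP2 : TPoint.PropertyP2 T μ)
    [MeasurableSpace Ω] (P : MeasureTheory.Measure Ω) [MeasureTheory.IsProbabilityMeasure P]
    (S : Ω ≃ᵐ Ω) (hS : Ergodic S P)
    (k : ℕ) (α : Fin k → ℝ≥0) (hα : ∀ i, 0 < α i)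
    (N : Fin k → Ω → TPoint.Config X)
    (hN : ∀ i, TPoint.IsTPointProcess T μ P S (N i))
    (hPoisson : ∀ i, TPoint.IsPoissonProcess (α i • μ) P (N i))
    (hdiss : ∀ i j, i ≠ j → TPoint.Dissociated P S (N i) (N j)) :
    ProbabilityTheory.iIndepFun N P := by
  have hne : Nonempty X := by
    by_contra h
    rw [not_nonempty_iff] at h
    simp [Measure.eq_zero_of_isEmpty μ] at hμ_inf
  have hatoms : NullSingletonClass μ :=
    TPoint.nullSingletonClass_of_ergodic_of_conservative T.injective hμ_bdd hμ_inf hT_erg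
      hT_cons
  have h : TPoint.DissociatedPoisson T μ P S α N := ⟨hα, hN, hPoisson, hdiss⟩
  exact h.iIndepFun hμ_bdd hμ_inf hP2 hS.toMeasurePreserving
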